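/- For non-negative integers $n,t$, a partial Hadamard matrix of size $n\times t$ is an $n\times t$ matrix with entries $\pm1$ whose distinct rows are pairwise orthogonal; let $N_{n,t}$ be the number of these matrices. Put $d=\binom n2$ and, for real $t>0$, $$A(n,t)=2^{2d-n+1}(2\pi t)^{-d/2},\qquad L(n,t,\delta)=\bigl[1+\tfrac49t^2(n\delta)^6\bigr]^{-1/2}\bigl[1-\tfrac1{12}(n\delta)^4\bigr]^{t}\bigl[1-e^{-\frac12t\delta^2}\bigr]^{d/2},$$ $$L(n,t)=\sup_{0<\delta<1/n}\Bigl\{L(n,t,\delta)-A(n,t)^{-1}e^{-\frac{11}{24}t\delta^2}\Bigr\},$$ and, for positive integers $t$, $R(n,t)=N_{n,t}/\bigl(2^{nt}A(n,t)\bigr)$. Let $M\subset\mathbb Z^d$ be the set of all vectors $(y_iy_j)_{1\le i<j\le n}$ with $y\in\{-1,1\}^n$, let $(X_t)$ be the random walk on $\mathbb Z^d$ whose independent increments are uniformly distributed on $M$, and let $P_n^t(x,y)=\mathbb P(X_t=y\mid X_0=x)$. (i) Abundance. For all sufficiently large $n$ and all integers $t>n^8$, $$R(n,t)\le e^{n^4t^{-1/2}}+t^{d/2}e^{-\frac{11}{24}t^{1/4}}.$$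 (ii) Existence. For all real $\alpha,\beta>0$ and all sufficiently large $n$ (depending on $\alpha,\beta$), with $t=n^{12+3\beta+2\alpha}$ (a real number), $$L(n,t)>e^{-\frac14n^{-2\alpha}}+A(n,t)^{-1}e^{-\frac{11}{24}n^{2+\beta}};$$ in particular $L(n,t)>0$. For all sufficiently large $n$, there is an $n\times4t$ partial Hadamard matrix for every integer $t>n^{12}$. Moreover, for every $\epsilon>0$ and all sufficiently large $n$ (depending on $\epsilon$), $P_n^t(0,0)>0$ for every integer $t\ge n^{12+\epsilon}$ with $t\equiv0\pmod 4$. -/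

import Mathlib

namespace PartialHadamard

/-- An `n × t` partial Hadamard matrix: entries `±1`, distinct rows orthogonal. -/
def IsPartialHadamard {n t : ℕ} (H : Matrix (Fin n) (Fin t) ℤ) : Prop :=
  (∀ i j, H i j = 1 ∨ H i j = -1) ∧ ∀ i j, i ≠ j → H i ⬝ᵥ H j = 0

theorem finite_setOf_isPartialHadamard (n t : ℕ) :
    {H : Matrix (Fin n) (Fin t) ℤ | IsPartialHadamard H}.Finite := by
  refine Set.Finite.subset (s := Set.pi Set.univ fun _ : Fin n =>
    Set.pi Set.univ fun _ : Fin t => ({1, -1} : Set ℤ)) ?_ ?_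
  · exact Set.Finite.pi fun _ => Set.Finite.pi fun _ => by simp
  · intro H hH i _ j _
    simpa using hH.1 i j

/-- The number `N_{n,t}` of `n × t` partial Hadamard matrices (a finite number). -/
noncomputable def count (n t : ℕ) : ℕ :=
  {H : Matrix (Fin n) (Fin t) ℤ | IsPartialHadamard H}.ncard

/-- The dimension `d = n choose 2`. -/
def dim (n : ℕ) : ℕ := n.choose 2

/-- The `d` coordinates are indexed by the pairs `i < j` in `{1, …, n}`. -/
abbrev Pairs (n : ℕ) : Type := {p : Fin n × Fin n // p.1 < p.2}

/-- The vector `Z(y)` of all products `y_i y_j`, `i < j`, for a sign vector `y`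
(the signs `±1` are the units of `ℤ`). -/
def pairProducts {n : ℕ} (y : Fin n → ℤˣ) : Pairs n → ℤ :=
  fun p => (y p.1.1 : ℤ) * (y p.1.2 : ℤ)

/-- The set `M` of increments of the walk. -/
def increments (n : ℕ) : Finset (Pairs n → ℤ) :=
  Finset.univ.image (pairProducts (n := n))

theorem increments_nonempty (n : ℕ) : (increments n).Nonempty :=
  Finset.univ_nonempty.image _

/-- The law of `X_t` given `X_0 = x`, where `(X_t)` is the random walk on `ℤ^d` whose
independent increments are uniformly distributed on `M`. -/
noncomputable def walkLaw (n : ℕ) (x : Pairs n → ℤ) : ℕ → PMF (Pairs n → ℤ)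
  | 0 => PMF.pure x
  | t + 1 => (walkLaw n x t).bind fun z =>
      (PMF.uniformOfFinset (increments n) (increments_nonempty n)).map fun m => z + m

/-- The transition probability `P_n^t(x, y) = ℙ(X_t = y | X_0 = x)`. -/
noncomputable def transProb (n t : ℕ) (x y : Pairs n → ℤ) : ℝ :=
  (walkLaw n x t y).toReal

/-- `A(n,t) = 2^{2d-n+1} (2πt)^{-d/2}`. -/
noncomputable def normalizer (n : ℕ) (t : ℝ) : ℝ :=
  2 ^ (2 * (dim n : ℤ) - (n : ℤ) + 1) * (2 * Real.pi * t) ^ (-((dim n : ℝ) / 2))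

/-- The normalized count `R(n,t) = N_{n,t} / (2^{nt} A(n,t))`. -/
noncomputable def ratio (n t : ℕ) : ℝ :=
  (count n t : ℝ) / (2 ^ (n * t) * normalizer n t)

/-- `L(n,t,δ)`. -/
noncomputable def lowerFactor (n : ℕ) (t δ : ℝ) : ℝ :=
  (1 + 4 / 9 * t ^ 2 * ((n : ℝ) * δ) ^ 6) ^ (-(1 / 2) : ℝ)
    * (1 - 1 / 12 * ((n : ℝ) * δ) ^ 4) ^ t
    * (1 - Real.exp (-(1 / 2) * t * δ ^ 2)) ^ ((dim n : ℝ) / 2)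

/-- The set of values `L(n,t,δ) - A(n,t)⁻¹ exp(-(11/24) t δ²)`, `0 < δ < 1/n`. -/
def lowerValues (n : ℕ) (t : ℝ) : Set ℝ :=
  (fun δ : ℝ => lowerFactor n t δ
    - (normalizer n t)⁻¹ * Real.exp (-(11 / 24) * t * δ ^ 2)) '' Set.Ioo 0 (n : ℝ)⁻¹

/-- `L(n,t)`: the supremum, over `0 < δ < 1/n`, of
`L(n,t,δ) - A(n,t)⁻¹ exp(-(11/24) t δ²)`. -/
noncomputable def lowerBound (n : ℕ) (t : ℝ) : ℝ := sSup (lowerValues n t)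

theorem lowerValues_nonempty {n : ℕ} (hn : 0 < n) (t : ℝ) : (lowerValues n t).Nonempty :=
  (Set.nonempty_Ioo.2 (by positivity)).image _

theorem lowerValues_bddAbove {n : ℕ} {t : ℝ} (ht : 0 < t) :
    BddAbove (lowerValues n t) := by
  refine ⟨1, ?_⟩
  rintro _ ⟨δ, ⟨h0, h1⟩, rfl⟩
  have hA : 0 ≤ (normalizer n t)⁻¹ * Real.exp (-(11 / 24) * t * δ ^ 2) := by
    unfold normalizer; positivity
  have hnd : 0 ≤ (n : ℝ) * δ := by positivity
  have hnd1 : (n : ℝ) * δ ≤ 1 := by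
    rcases Nat.eq_zero_or_pos n with rfl | hn
    · simp
    · have hn' : (0 : ℝ) < n := by exact_mod_cast hn
      calc (n : ℝ) * δ ≤ n * (n : ℝ)⁻¹ := by gcongr
        _ = 1 := mul_inv_cancel₀ hn'.ne'
  have h4 : ((n : ℝ) * δ) ^ 4 ≤ 1 := pow_le_one₀ hnd hnd1
  have h4' : 0 ≤ ((n : ℝ) * δ) ^ 4 := by positivity
  have he : Real.exp (-(1 / 2) * t * δ ^ 2) ≤ 1 := by
    apply Real.exp_le_one_iff.2
    have : 0 ≤ t * δ ^ 2 := by positivity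
    linarith
  have he' := Real.exp_pos (-(1 / 2) * t * δ ^ 2)
  have a1 : (1 + 4 / 9 * t ^ 2 * ((n : ℝ) * δ) ^ 6) ^ (-(1 / 2) : ℝ) ≤ 1 :=
    Real.rpow_le_one_of_one_le_of_nonpos
      (le_add_of_nonneg_right (by positivity)) (by norm_num)
  have a2 : (1 - 1 / 12 * ((n : ℝ) * δ) ^ 4) ^ t ≤ 1 :=
    Real.rpow_le_one (by linarith) (by linarith) ht.le
  have a3 : (1 - Real.exp (-(1 / 2) * t * δ ^ 2)) ^ ((dim n : ℝ) / 2) ≤ 1 :=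
    Real.rpow_le_one (by linarith) (by linarith) (by positivity)
  have b2 : 0 ≤ (1 - 1 / 12 * ((n : ℝ) * δ) ^ 4) ^ t := Real.rpow_nonneg (by linarith) _
  have b3 : 0 ≤ (1 - Real.exp (-(1 / 2) * t * δ ^ 2)) ^ ((dim n : ℝ) / 2) :=
    Real.rpow_nonneg (by linarith) _
  have hL : lowerFactor n t δ ≤ 1 := by
    unfold lowerFactor
    exact mul_le_one₀ (mul_le_one₀ a1 b2 a2) b3 a3
  show lowerFactor n t δ - _ ≤ 1
  linarith

end PartialHadamard

/-! Abundance is Fourier analysis on the torus of dimension `dim n`. The columns of a partial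
Hadamard matrix are the steps of a closed walk, so the count is, up to `(2π)^d`, the integral of the
`t`-th power of the unnormalized characteristic function of one increment. The torus is cut into `4
^ d` cubes of half-width `π/4` centred at the points `(π/2) m`. At such a centre the increments
contribute a common phase times a character of the sign group (`pairChar`).

Let `δ` be a small radius. If some coordinate exceeds `δ` (`norm_charSum_le_of_le`), or if the
character is nontrivial (`norm_charSum_le_of_ne_one`), flipping signs shows that the integrand is
exponentially small. Near a centre with trivial character, fourth-moment bounds for quadratic forms
in signs give Gaussian decay (`norm_charSum_le_gaussian`). There are at most `2^(2d-n+1)` such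
centres, and the Gaussian integral over each then produces `normalizer`. Taking `δ = t^(-3/8)`
finishes `ratio_le`.

The lower bound on `lowerBound` is elementary: one value of `δ` is inserted into the supremum, and
Bernoulli's inequality controls the factors.

Existence does not use that bound; it is by construction. Paley matrices of order `4m` with `m` odd
and Sylvester matrices of order `4 * 2^l` can be placed side by side, and since `m` and `2^l` are
coprime, every large multiple of `4` occurs as a number of columns. Such a matrix is a closed walk
of positive probability, which gives the return probabilities. -/

namespace PartialHadamard

/-! ### Explicit constructions and return probabilities -/

section Existence

open Finset

/-- There is an `n × s` partial Hadamard matrix. -/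
def Realizable (n s : ℕ) : Prop := ∃ H : Matrix (Fin n) (Fin s) ℤ, IsPartialHadamard H

theorem Realizable.of_family {n : ℕ} {ρ κ : Type*} [Fintype ρ] [Fintype κ]
    (hn : n ≤ Fintype.card ρ) (f : ρ → κ → ℤ) (hf : ∀ i k, f i k = 1 ∨ f i k = -1)
    (ho : ∀ i j, i ≠ j → ∑ k, f i k * f j k = 0) : Realizable n (Fintype.card κ) := by
  obtain ⟨g⟩ : Nonempty (Fin n ↪ ρ) :=
    Function.Embedding.nonempty_of_card_le (by simpa using hn)
  refine ⟨fun i j => f (g i) ((Fintype.equivFin κ).symm j), fun i j => hf _ _, fun i j hij => ?_⟩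
  rw [← ho (g i) (g j) (g.injective.ne hij)]
  exact Equiv.sum_comp (Fintype.equivFin κ).symm fun k => f (g i) k * f (g j) k

theorem Realizable.add {n s s' : ℕ} (h : Realizable n s) (h' : Realizable n s') : Realizable n (s + s') := by
  obtain ⟨H, hH⟩ := h
  obtain ⟨K, hK⟩ := h'
  have := Realizable.of_family (ρ := Fin n) (κ := Fin s ⊕ Fin s') (n := n) (by simp)
    (fun i => Sum.elim (H i) (K i)) (fun i k => by
      rcases k with k | k
      · exact hH.1 i k
      · exact hK.1 i k) (fun i j hij => by
      have h1 := hH.2 i j hij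
      have h2 := hK.2 i j hij
      simp only [dotProduct] at h1 h2
      simp [h1, h2])
  simpa using this

theorem Realizable.zero (n : ℕ) : Realizable n 0 :=
  ⟨fun _ k => k.elim0, fun _ k => k.elim0, fun _ _ _ => by simp [dotProduct]⟩

theorem Realizable.mul_left {n s : ℕ} (h : Realizable n s) (a : ℕ) : Realizable n (a * s) := by
  induction a with
  | zero => simpa using Realizable.zero n
  | succ a ih => rw [Nat.succ_mul]; exact ih.add h

/-- Sylvester's Hadamard matrices of order `2 ^ j`. -/
theorem realizable_two_pow {n j : ℕ} (h : n ≤ 2 ^ j) : Realizable n (2 ^ j) := by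
  let e : Bool → Bool → ℤ := fun a b => if a && b then -1 else 1
  have := Realizable.of_family (ρ := Fin j → Bool) (κ := Fin j → Bool) (n := n) (by simpa using h)
    (fun a b => ∏ i, e (a i) (b i)) (fun a b => by
      rw [← Int.isUnit_iff]
      refine (IsUnit.prod_univ_iff).2 fun i => ?_
      rw [Int.isUnit_iff]
      simp only [e]
      split_ifs <;> simp) (fun a a' haa => by
      simp_rw [← Finset.prod_mul_distrib]
      have := Finset.prod_univ_sum (fun _ : Fin j => (univ : Finset Bool))
        fun i b => e (a i) b * e (a' i) b
      rw [Fintype.piFinset_univ] at this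
      rw [← this]
      -- The inner product of two rows factors over the coordinates; a coordinate where the row
      -- indices differ contributes the factor `1 - 1 = 0`.
      obtain ⟨i, hi⟩ := Function.ne_iff.1 haa
      refine Finset.prod_eq_zero (mem_univ i) ?_
      revert hi
      generalize a i = u
      generalize a' i = v
      revert u v
      decide)
  simpa using this

/-- Paley's construction: the quadratic residue matrix over a field with `q ≡ 3 mod 4` elements,
bordered by one column. -/
theorem realizable_paley {n : ℕ} {F : Type} [Field F] [Fintype F] [DecidableEq F]
    (hF : Fintype.card F % 4 = 3) (hn : n ≤ Fintype.card F) :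
    Realizable n (Fintype.card F + 1) := by
  have h2 : ringChar F ≠ 2 := by
    intro h
    have := FiniteField.even_card_iff_char_two.1 h
    omega
  set χ := quadraticChar F with hχ
  have hneg : χ (-1) = -1 := by
    rw [hχ, quadraticChar_neg_one h2, ZMod.χ₄_nat_three_mod_four hF]
  have hinv : χ⁻¹ = χ := (quadraticChar_isQuadratic F).inv
  have hJ : ∑ z, χ z * χ (1 - z) = 1 := by
    have := jacobiSum_nontrivial_inv (χ := χ) (quadraticChar_ne_one h2)
    rw [hinv, hneg] at this
    simpa [jacobiSum] using this
  have hcorr : ∀ x x' : F, x ≠ x' → ∑ y, χ (y - x) * χ (y - x') = -1 := by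
    intro x x' hx
    have hc : x' - x ≠ 0 := sub_ne_zero.2 hx.symm
    have hcc : χ (x' - x) * χ (x' - x) = 1 := by
      rcases quadraticChar_dichotomy hc with h | h <;> simp [hχ, h]
    -- The substitution `y = x + (x' - x) z` turns the correlation into minus the Jacobi sum of `χ`
    -- with itself.
    rw [← Equiv.sum_comp ((Equiv.mulLeft₀ (x' - x) hc).trans (Equiv.addLeft x))]
    have : ∀ z, χ (((Equiv.mulLeft₀ (x' - x) hc).trans (Equiv.addLeft x)) z - x)
        * χ (((Equiv.mulLeft₀ (x' - x) hc).trans (Equiv.addLeft x)) z - x')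
        = -(χ z * χ (1 - z)) := by
      intro z
      have e1 : ((Equiv.mulLeft₀ (x' - x) hc).trans (Equiv.addLeft x)) z - x = (x' - x) * z := by
        simp
      have e2 : ((Equiv.mulLeft₀ (x' - x) hc).trans (Equiv.addLeft x)) z - x'
          = (x' - x) * (-1 * (1 - z)) := by
        simp; ring
      rw [e1, e2]
      simp only [map_mul, hneg]
      linear_combination (-(χ z * χ (1 - z))) * hcc
    simp_rw [this]
    rw [Finset.sum_neg_distrib, hJ]
  have h0 : χ 0 = 0 := MulChar.map_zero χ
  -- The constant column contributes `1` and cancels the correlation `-1`. Filling the zeros on the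
  -- diagonal with `1` adds `χ (x - x') + χ (x' - x)`, which vanishes because `χ` is odd.
  have := Realizable.of_family (ρ := F) (κ := Option F) (n := n) hn
    (fun x k => k.elim (-1) fun y => χ (y - x) + if y = x then 1 else 0) (fun x k => by
      rcases k with _ | y
      · right; rfl
      · by_cases h : y = x
        · left; simp [h, h0]
        · simp only [Option.elim, if_neg h, add_zero]
          exact quadraticChar_dichotomy (sub_ne_zero.2 h)) (fun x x' hx => by
      rw [Fintype.sum_option]
      have hsplit : ∀ y, (χ (y - x) + if y = x then 1 else 0) * (χ (y - x') + if y = x' then 1 else 0)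
          = χ (y - x) * χ (y - x') + (if y = x then χ (y - x') else 0)
            + (if y = x' then χ (y - x) else 0) := by
        intro y
        by_cases h : y = x
        · subst h; simp [hx, h0]
        · by_cases h' : y = x'
          · subst h'; simp [h, h0]
          · simp [h, h']
      simp only [Option.elim]
      simp_rw [hsplit]
      rw [Finset.sum_add_distrib, Finset.sum_add_distrib, hcorr x x' hx]
      simp only [Finset.sum_ite_eq', mem_univ, if_true]
      have : χ (x' - x) = - χ (x - x') := by
        rw [← neg_sub x x', ← neg_one_mul, map_mul, hneg]; ring
      rw [this]; ring)
  simpa using this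

/-- An odd power of `3` is `3` modulo `8`, so a Paley order `q + 1` with such `q` is four times an
odd number. Powers of `9` are dense enough to keep `q` of order `n ^ 2`. -/
theorem exists_odd_realizable {n : ℕ} (hn : 2 ≤ n) :
    ∃ m, Odd m ∧ 4 * m ≤ 27 * n ^ 2 + 1 ∧ Realizable n (4 * m) := by
  set l := Nat.log 3 n
  have h1 : 3 ^ l ≤ n := Nat.pow_log_le_self 3 (by omega)
  have h2 : n < 3 ^ (l + 1) := Nat.lt_pow_succ_log_self (by norm_num) n
  have h8 : 3 ^ (2 * l + 3) % 8 = 3 := by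
    rw [pow_add, pow_mul, Nat.mul_mod, Nat.pow_mod]; norm_num
  have hle : 3 ^ (2 * l + 3) ≤ 27 * n ^ 2 := by
    calc 3 ^ (2 * l + 3) = 27 * (3 ^ l) ^ 2 := by ring
      _ ≤ 27 * n ^ 2 := by gcongr
  have : Fact (Nat.Prime 3) := ⟨Nat.prime_three⟩
  let _ : Fintype (GaloisField 3 (2 * l + 3)) := Fintype.ofFinite _
  classical
  have hcard : Fintype.card (GaloisField 3 (2 * l + 3)) = 3 ^ (2 * l + 3) := by
    rw [← Nat.card_eq_fintype_card]
    exact GaloisField.card 3 _ (by omega)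
  have hA := realizable_paley (n := n) (F := GaloisField 3 (2 * l + 3)) (by rw [hcard]; omega)
    (by rw [hcard]; exact h2.le.trans (Nat.pow_le_pow_right (by norm_num) (by omega)))
  rw [hcard] at hA
  refine ⟨(3 ^ (2 * l + 3) + 1) / 4, ?_, by omega, ?_⟩
  · rw [Nat.odd_iff]; omega
  · rwa [Nat.mul_div_cancel' (by omega)]

/-- For coprime `m` and `2 ^ l`, every integer from `(m - 1)(2 ^ l - 1)` on is a nonnegative
combination of the two. That threshold is only of order `n ^ 3`, far below `n ^ 12`. -/
theorem realizable_of_pow_lt {n : ℕ} (hn : 2 ≤ n) {t : ℕ} (ht : n ^ 12 < t) : Realizable n (4 * t) := by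
  obtain ⟨m, hmo, hm, hA⟩ := exists_odd_realizable hn
  set l := Nat.log 2 n
  have h1 : 2 ^ l ≤ n := Nat.pow_log_le_self 2 (by omega)
  have h2 : n < 2 ^ (l + 1) := Nat.lt_pow_succ_log_self (by norm_num) n
  have hS : Realizable n (4 * 2 ^ l) := by
    have : 4 * 2 ^ l = 2 ^ (l + 2) := by ring
    rw [this]
    exact realizable_two_pow (h2.le.trans (Nat.pow_le_pow_right (by norm_num) (by omega)))
  have hco : Nat.gcd m (2 ^ l) = 1 :=
    Nat.Coprime.pow_right _ (Nat.coprime_two_right.2 hmo)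
  have hle : m.pred * (2 ^ l).pred ≤ t := by
    have ha : m ≤ 7 * n ^ 2 := by nlinarith
    calc m.pred * (2 ^ l).pred ≤ (7 * n ^ 2) * n :=
          Nat.mul_le_mul ((Nat.pred_le _).trans ha) ((Nat.pred_le _).trans h1)
      _ ≤ (n ^ 9) * n ^ 2 * n := by
          have : 2 ^ 9 ≤ n ^ 9 := Nat.pow_le_pow_left hn 9
          gcongr; omega
      _ = n ^ 12 := by ring
      _ ≤ t := ht.le
  obtain ⟨a, b, hab⟩ :=
    Nat.exists_add_mul_eq_of_gcd_dvd_of_mul_pred_le m (2 ^ l) t (by rw [hco]; exact one_dvd _) hle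
  have := (hA.mul_left a).add (hS.mul_left b)
  have he : a * (4 * m) + b * (4 * 2 ^ l) = 4 * t := by rw [← hab]; ring
  rwa [he] at this

theorem walkLaw_add_sum_ne_zero (n : ℕ) (x : Pairs n → ℤ) (t : ℕ) (y : Fin t → Fin n → ℤˣ) :
    walkLaw n x t (x + ∑ c, pairProducts (y c)) ≠ 0 := by
  rw [← PMF.mem_support_iff]
  induction t with
  | zero => simp [walkLaw]
  | succ t ih =>
    rw [walkLaw, PMF.mem_support_bind_iff]
    refine ⟨_, ih fun c => y c.castSucc, ?_⟩
    rw [PMF.mem_support_map_iff]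
    refine ⟨pairProducts (y (Fin.last t)), ?_, ?_⟩
    · rw [PMF.mem_support_uniformOfFinset_iff]
      exact Finset.mem_image_of_mem _ (mem_univ _)
    · rw [Fin.sum_univ_castSucc, add_assoc]

/-- The columns of a partial Hadamard matrix give a closed walk. -/
theorem IsPartialHadamard.exists_signs {n t : ℕ} {H : Matrix (Fin n) (Fin t) ℤ}
    (hH : IsPartialHadamard H) : ∃ Y : Fin t → Fin n → ℤˣ,
      (∀ i j, (Y j i : ℤ) = H i j) ∧ ∑ c, pairProducts (Y c) = 0 := by
  have hu : ∀ i j, ∃ u : ℤˣ, (u : ℤ) = H i j := fun i j => by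
    rcases hH.1 i j with h | h
    · exact ⟨1, by simp [h]⟩
    · exact ⟨-1, by simp [h]⟩
  choose u hu using hu
  refine ⟨fun j i => u i j, hu, ?_⟩
  ext p
  simpa [pairProducts, hu, dotProduct, Finset.sum_apply] using hH.2 p.1.1 p.1.2 (ne_of_lt p.2)

theorem Realizable.transProb_pos {n t : ℕ} (h : Realizable n t) : 0 < transProb n t 0 0 := by
  obtain ⟨H, hH⟩ := h
  obtain ⟨Y, -, h0⟩ := hH.exists_signs
  have := walkLaw_add_sum_ne_zero n 0 t Y
  rw [h0, add_zero] at this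
  exact ENNReal.toReal_pos this (PMF.apply_ne_top _ _)

theorem eventually_transProb_pos {ε : ℝ} (hε : 0 < ε) :
    ∀ᶠ n : ℕ in Filter.atTop, ∀ t : ℕ,
      (n : ℝ) ^ (12 + ε) ≤ (t : ℝ) → t % 4 = 0 → 0 < transProb n t 0 0 := by
  -- The spare factor `n ^ ε` absorbs the `4` in `t = 4 * s`.
  have h4 : ∀ᶠ n : ℕ in Filter.atTop, 4 < (n : ℝ) ^ ε :=
    ((tendsto_rpow_atTop hε).comp tendsto_natCast_atTop_atTop).eventually_gt_atTop 4
  filter_upwards [h4, Filter.eventually_ge_atTop 2] with n hn h2 t ht hmod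
  obtain ⟨s, rfl⟩ : ∃ s, t = 4 * s := ⟨t / 4, by omega⟩
  refine (realizable_of_pow_lt h2 ?_).transProb_pos
  have hn0 : (0 : ℝ) < n := by positivity
  rw [Real.rpow_add hn0] at ht
  have h12 : (n : ℝ) ^ (12 : ℝ) = (n : ℝ) ^ 12 := by exact_mod_cast Real.rpow_natCast (n : ℝ) 12
  rw [h12] at ht
  have hp : (0 : ℝ) < (n : ℝ) ^ 12 := by positivity
  push_cast at ht
  have : (n : ℝ) ^ 12 < s := by nlinarith
  exact_mod_cast this

end Existence

end PartialHadamard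

namespace PartialHadamard

/-! ### The lower bound for `L(n,t)` -/

section LowerBound

open Filter Topology

theorem dim_le_sq (n : ℕ) : (dim n : ℝ) ≤ (n : ℝ) ^ 2 / 2 := by
  unfold dim
  rw [Nat.cast_choose_two]
  nlinarith [Nat.cast_nonneg (α := ℝ) n]

theorem four_mul_sub_one_le_dim {n : ℕ} (hn : 4 ≤ n) : 2 * ((n : ℝ) - 1) ≤ dim n := by
  unfold dim
  rw [Nat.cast_choose_two]
  have : (4 : ℝ) ≤ n := by exact_mod_cast hn
  nlinarith

theorem normalizer_pos (n : ℕ) {t : ℝ} (ht : 0 < t) : 0 < normalizer n t := by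
  unfold normalizer; positivity

/-- Since `2π ≤ 2 ^ 3`, it suffices that `3d/2 ≤ 2d - n + 1`, that is `2(n - 1) ≤ d`, which is where
`n ≥ 4` enters. -/
theorem inv_normalizer_le {n : ℕ} (hn : 4 ≤ n) {t : ℝ} (ht : 0 < t) :
    (normalizer n t)⁻¹ ≤ t ^ ((dim n : ℝ) / 2) := by
  have hd := four_mul_sub_one_le_dim hn
  have hexp : (2 * Real.pi) ^ ((dim n : ℝ) / 2) ≤ 2 ^ (2 * (dim n : ℤ) - (n : ℤ) + 1) := by
    calc (2 * Real.pi) ^ ((dim n : ℝ) / 2) ≤ ((2 : ℝ) ^ (3 : ℝ)) ^ ((dim n : ℝ) / 2) := by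
          gcongr
          norm_num
          linarith [Real.pi_lt_four]
      _ = 2 ^ (3 * ((dim n : ℝ) / 2)) := by rw [← Real.rpow_mul (by norm_num)]
      _ ≤ 2 ^ ((2 * (dim n : ℤ) - (n : ℤ) + 1 : ℤ) : ℝ) := by
          apply Real.rpow_le_rpow_of_exponent_le (by norm_num)
          push_cast
          linarith
      _ = _ := Real.rpow_intCast _ _
  unfold normalizer
  rw [mul_inv, Real.rpow_neg (by positivity), inv_inv, Real.mul_rpow (by positivity) ht.le,
    ← mul_assoc]
  have h2 : (0 : ℝ) < 2 ^ (2 * (dim n : ℤ) - (n : ℤ) + 1) := by positivity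
  have : (2 ^ (2 * (dim n : ℤ) - (n : ℤ) + 1))⁻¹ * (2 * Real.pi) ^ ((dim n : ℝ) / 2) ≤ 1 := by
    rw [inv_mul_le_one₀ h2]; exact hexp
  calc _ ≤ 1 * t ^ ((dim n : ℝ) / 2) := by gcongr
    _ = _ := one_mul _

theorem exp_neg_le_inv_sqrt_one_add {x : ℝ} (hx : 0 ≤ x) :
    Real.exp (-(2 / 9) * x) ≤ (1 + 4 / 9 * x) ^ (-(1 / 2) : ℝ) := by
  have h : 1 + 4 / 9 * x ≤ Real.exp (4 / 9 * x) := by linarith [Real.add_one_le_exp (4 / 9 * x)]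
  calc Real.exp (-(2 / 9) * x) = (Real.exp (4 / 9 * x)) ^ (-(1 / 2) : ℝ) := by
        rw [← Real.exp_mul]; congr 1; ring
    _ ≤ _ := Real.rpow_le_rpow_of_nonpos (by positivity) h (by norm_num)

/-- Bernoulli's inequality linearizes the last two factors (their exponents `t` and `d/2` are at
least `1`), and `E B C ≥ E - (1 - B) - (1 - C)` for numbers in `[0, 1]`. -/
theorem mul_one_sub_mul_one_sub_le_lowerFactor {n : ℕ} {t δ x w e : ℝ} (ht : 1 ≤ t)
    (hd : 2 ≤ dim n) (hx : t ^ 2 * ((n : ℝ) * δ) ^ 6 = x) (hx0 : 0 ≤ x)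
    (hw : ((n : ℝ) * δ) ^ 4 = w) (hw0 : 0 ≤ w) (hw1 : w ≤ 1)
    (he : Real.exp (-(1 / 2) * t * δ ^ 2) = e) :
    Real.exp (-(2 / 9) * x) - t * w / 12 - dim n / 2 * e ≤ lowerFactor n t δ := by
  have he0 : 0 < e := he ▸ Real.exp_pos _
  have he1 : e ≤ 1 := by
    rw [← he]; apply Real.exp_le_one_iff.2; nlinarith [sq_nonneg δ]
  have hd' : (2 : ℝ) ≤ dim n := by exact_mod_cast hd
  have b1 := exp_neg_le_inv_sqrt_one_add hx0
  have b2 : 1 - t * w / 12 ≤ (1 - 1 / 12 * w) ^ t := by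
    have := one_add_mul_self_le_rpow_one_add (s := -(1 / 12 * w)) (by linarith) ht
    rw [← sub_eq_add_neg] at this
    linarith
  have b3 : 1 - dim n / 2 * e ≤ (1 - e) ^ ((dim n : ℝ) / 2) := by
    have := one_add_mul_self_le_rpow_one_add (s := -e) (by linarith)
      (p := (dim n : ℝ) / 2) (by linarith)
    rw [← sub_eq_add_neg] at this
    linarith
  have c2 : 0 ≤ (1 - 1 / 12 * w) ^ t := Real.rpow_nonneg (by linarith) _
  have c3 : 0 ≤ (1 - e) ^ ((dim n : ℝ) / 2) := Real.rpow_nonneg (by linarith) _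
  have d2 : (1 - 1 / 12 * w) ^ t ≤ 1 := Real.rpow_le_one (by linarith) (by linarith) (by linarith)
  have d3 : (1 - e) ^ ((dim n : ℝ) / 2) ≤ 1 :=
    Real.rpow_le_one (by linarith) (by linarith) (by linarith)
  unfold lowerFactor
  rw [he, hw, mul_assoc (4 / 9 : ℝ), hx]
  set E := Real.exp (-(2 / 9) * x)
  set B := (1 - 1 / 12 * w) ^ t
  set C := (1 - e) ^ ((dim n : ℝ) / 2)
  have hE0 : 0 ≤ E := Real.exp_nonneg _
  have hE1 : E ≤ 1 := Real.exp_le_one_iff.2 (by linarith)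
  calc E - t * w / 12 - dim n / 2 * e ≤ E - (1 - B) - (1 - C) := by linarith
    _ ≤ E * B * C := by
        nlinarith [mul_nonneg (sub_nonneg.2 hE1) (sub_nonneg.2 d2),
          mul_nonneg (sub_nonneg.2 (mul_le_one₀ hE1 c2 d2)) (sub_nonneg.2 d3)]
    _ ≤ _ := by gcongr

/-- Asymptotics: `log n` is dominated by every positive power of `n`. -/
theorem eventually_const_mul_log_le_rpow (C : ℝ) {β : ℝ} (hβ : 0 < β) :
    ∀ᶠ n : ℕ in atTop, C * Real.log n ≤ (n : ℝ) ^ β := by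
  have h := ((isLittleO_log_rpow_atTop hβ).const_mul_left C).def (c := 1) one_pos
  filter_upwards [tendsto_natCast_atTop_atTop.eventually h] with n hn
  rw [one_mul, Real.norm_of_nonneg (r := (n : ℝ) ^ β) (by positivity)] at hn
  exact (le_abs_self _).trans hn

theorem eventually_lowerBound_gt {α β : ℝ} (hα : 0 < α) (hβ : 0 < β) :
    ∀ᶠ n : ℕ in atTop,
      Real.exp (-(1 / 4) * (n : ℝ) ^ (-2 * α))
          + (normalizer n ((n : ℝ) ^ (12 + 3 * β + 2 * α)))⁻¹
            * Real.exp (-(11 / 24) * (n : ℝ) ^ (2 + β))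
        < lowerBound n ((n : ℝ) ^ (12 + 3 * β + 2 * α)) := by
  set γ := 12 + 3 * β + 2 * α with hγ
  filter_upwards [eventually_const_mul_log_le_rpow (24 * γ) hβ,
    eventually_const_mul_log_le_rpow (24 * (2 * α + 4)) hβ, eventually_ge_atTop 10000]
    with n hlog1 hlog2 hn
  have hnr : (10000 : ℝ) ≤ n := by exact_mod_cast hn
  have hn0 : (0 : ℝ) < n := by linarith
  have hn1 : (1 : ℝ) ≤ n := by linarith
  set t := (n : ℝ) ^ γ with ht
  have ht0 : 0 < t := by positivity
  have ht1 : 1 ≤ t := Real.one_le_rpow hn1 (by rw [hγ]; positivity)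
  set x := (n : ℝ) ^ (-2 * α) with hx
  have hx0 : 0 < x := by positivity
  have hx1 : x ≤ 1 := Real.rpow_le_one_of_one_le_of_nonpos hn1 (by linarith)
  -- The exponent is chosen so that `t² (nδ)⁶ = n ^ (-2α)` and `t δ² = n ^ (2 + β)` at once.
  set δ := (n : ℝ) ^ (-(5 + β + α)) with hδ
  have hδ0 : 0 < δ := by positivity
  have hnδ : (n : ℝ) * δ = (n : ℝ) ^ (-(4 + β + α)) := by
    rw [hδ]
    nth_rewrite 1 [← Real.rpow_one (n : ℝ)]
    rw [← Real.rpow_add hn0]; congr 1; ring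
  have pw : ∀ (r : ℝ) (k : ℕ), ((n : ℝ) ^ r) ^ k = (n : ℝ) ^ (r * k) := fun r k => by
    rw [Real.rpow_mul hn0.le, Real.rpow_natCast]
  have hδlt : δ < (n : ℝ)⁻¹ := by
    rw [← Real.rpow_neg_one]
    exact Real.rpow_lt_rpow_of_exponent_lt (by linarith) (by linarith)
  have hX : t ^ 2 * ((n : ℝ) * δ) ^ 6 = x := by
    rw [hnδ, ht, pw, pw, ← Real.rpow_add hn0, hx]; congr 1; push_cast; rw [hγ]; ring
  have hT : t * δ ^ 2 = (n : ℝ) ^ (2 + β) := by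
    rw [ht, hδ, pw, ← Real.rpow_add hn0]; congr 1; push_cast; rw [hγ]; ring
  have hw0 : 0 ≤ ((n : ℝ) * δ) ^ 4 := by positivity
  have hw1 : ((n : ℝ) * δ) ^ 4 ≤ 1 := by
    refine pow_le_one₀ (by positivity) ?_
    rw [hnδ]
    exact Real.rpow_le_one_of_one_le_of_nonpos hn1 (by linarith)
  have htw : t * ((n : ℝ) * δ) ^ 4 ≤ x / n := by
    have e : x / n = (n : ℝ) ^ (-2 * α - 1) := by rw [Real.rpow_sub hn0, Real.rpow_one]
    rw [e, hnδ, ht, pw, ← Real.rpow_add hn0]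
    apply Real.rpow_le_rpow_of_exponent_le hn1
    push_cast; rw [hγ]; linarith
  have hd2 : 2 ≤ dim n := by
    have := four_mul_sub_one_le_dim (n := n) (by omega)
    have h2 : (2 : ℝ) ≤ dim n := by linarith
    exact_mod_cast h2
  have hlow := mul_one_sub_mul_one_sub_le_lowerFactor ht1 hd2 hX hx0.le rfl hw0 hw1 rfl
  -- the exponentially small terms
  set P := (n : ℝ) ^ (2 + β) with hP
  have hPe : P = (n : ℝ) ^ 2 * (n : ℝ) ^ β := by
    rw [hP, Real.rpow_add hn0]; congr 1; exact_mod_cast Real.rpow_natCast (n : ℝ) 2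
  have hlogn : 0 ≤ Real.log n := Real.log_nonneg hn1
  have hxlog : x = Real.exp (-(2 * α) * Real.log n) := by
    rw [hx, Real.rpow_def_of_pos hn0]; congr 1; ring
  have hsmall : Real.exp (-(1 / 12) * P) ≤ x / n ^ 4 := by
    have hlog4 : (n : ℝ) ^ 4 = Real.exp (4 * Real.log n) := by
      rw [← Real.log_rpow hn0, Real.exp_log (by positivity)]
      exact_mod_cast (Real.rpow_natCast (n : ℝ) 4).symm
    rw [hlog4, hxlog, ← Real.exp_sub]
    apply Real.exp_le_exp.2
    have : (n : ℝ) ^ β ≤ P := by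
      rw [hPe]; exact le_mul_of_one_le_left (by positivity) (one_le_pow₀ hn1)
    nlinarith
  have hinv : (normalizer n t)⁻¹ ≤ Real.exp (1 / 12 * P) := by
    refine (inv_normalizer_le (by omega) ht0).trans ?_
    rw [Real.rpow_def_of_pos ht0, ht, Real.log_rpow hn0]
    apply Real.exp_le_exp.2
    have hd := dim_le_sq n
    have hg : 0 ≤ γ * Real.log n := by rw [hγ]; positivity
    calc γ * Real.log n * ((dim n : ℝ) / 2) ≤ γ * Real.log n * ((n : ℝ) ^ 2 / 2 / 2) := by gcongr
      _ ≤ 1 / 12 * P := by rw [hPe]; nlinarith [sq_nonneg (n : ℝ)]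
  have hP0 : 0 < P := by positivity
  have hterm : (normalizer n t)⁻¹ * Real.exp (-(11 / 24) * P) ≤ x / n ^ 4 := by
    calc _ ≤ Real.exp (1 / 12 * P) * Real.exp (-(11 / 24) * P) := by gcongr
      _ ≤ Real.exp (-(1 / 12) * P) := by
          rw [← Real.exp_add]; apply Real.exp_le_exp.2; linarith
      _ ≤ _ := hsmall
  have hterm2 : (dim n : ℝ) / 2 * Real.exp (-(1 / 2) * P) ≤ x / n := by
    calc (dim n : ℝ) / 2 * Real.exp (-(1 / 2) * P)
        ≤ (n : ℝ) ^ 3 * (x / n ^ 4) := by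
          gcongr
          · have := dim_le_sq n
            nlinarith [sq_nonneg (n : ℝ)]
          · exact (Real.exp_le_exp.2 (by linarith)).trans hsmall
      _ = x / n := by field_simp
  have hxn : x / n ≤ x / 10000 := by gcongr
  have hxn4 : x / (n : ℝ) ^ 4 ≤ x / 10000 := by
    gcongr; exact hnr.trans (le_self_pow₀ hn1 (by norm_num))
  -- The room between `2/9` and `1/4` is `1/36`; it leaves `x / 72`, while each error term is at
  -- most `x / 10000`.
  have hgap : Real.exp (-(1 / 4) * x) + x / 72 ≤ Real.exp (-(2 / 9) * x) := by
    have e1 : Real.exp (-(2 / 9) * x) = Real.exp (-(1 / 4) * x) * Real.exp (x / 36) := by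
      rw [← Real.exp_add]; congr 1; ring
    have e2 := Real.add_one_le_exp (x / 36)
    have e3 := Real.add_one_le_exp (-(1 / 4) * x)
    have e4 : 1 / 2 ≤ Real.exp (-(1 / 4) * x) := by linarith
    have e5 := mul_le_mul_of_nonneg_left e2 (Real.exp_nonneg (-(1 / 4) * x))
    have e6 := mul_le_mul_of_nonneg_right e4 hx0.le
    rw [e1]
    linarith
  have hmem : lowerFactor n t δ - (normalizer n t)⁻¹ * Real.exp (-(11 / 24) * t * δ ^ 2)
      ∈ lowerValues n t := ⟨δ, ⟨hδ0, hδlt⟩, rfl⟩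
  have hsup := le_csSup (lowerValues_bddAbove ht0) hmem
  rw [show lowerBound n t = sSup (lowerValues n t) from rfl]
  rw [show -(11 / 24) * t * δ ^ 2 = -(11 / 24) * (t * δ ^ 2) by ring, hT] at hsup
  rw [show -(1 / 2) * t * δ ^ 2 = -(1 / 2) * (t * δ ^ 2) by ring, hT] at hlow
  linarith

end LowerBound

end PartialHadamard

namespace PartialHadamard

/-! ### Moments of linear and quadratic forms in random signs -/

section Moments

open Finset

theorem sum_signs_succ {n : ℕ} (g : (Fin (n + 1) → ℤˣ) → ℝ) :
    ∑ y, g y = ∑ y : Fin n → ℤˣ, (g (Fin.cons 1 y) + g (Fin.cons (-1) y)) := by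
  rw [← Equiv.sum_comp (Fin.consEquiv fun _ : Fin (n + 1) => ℤˣ), Fintype.sum_prod_type_right]
  refine Finset.sum_congr rfl fun y _ => ?_
  rw [UnitsInt.univ, Finset.sum_pair (by decide)]
  rfl

theorem card_signs (n : ℕ) : (Fintype.card (Fin n → ℤˣ) : ℝ) = 2 ^ n := by simp

/-- The Rademacher sum with coefficients `b`. -/
def signSum {n : ℕ} (b : Fin n → ℝ) (y : Fin n → ℤˣ) : ℝ := ∑ i, b i * ((y i : ℤ) : ℝ)

theorem signSum_cons {n : ℕ} (b : Fin (n + 1) → ℝ) (u : ℤˣ) (y : Fin n → ℤˣ) :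
    signSum b (Fin.cons u y) = b 0 * ((u : ℤ) : ℝ) + signSum (fun i => b i.succ) y := by
  simp [signSum, Fin.sum_univ_succ]

theorem sum_signSum_sq {n : ℕ} (b : Fin n → ℝ) :
    ∑ y, signSum b y ^ 2 = 2 ^ n * ∑ i, b i ^ 2 := by
  induction n with
  | zero => simp [signSum]
  | succ n ih =>
    have e : ∀ y, signSum b (Fin.cons 1 y) ^ 2 + signSum b (Fin.cons (-1) y) ^ 2
        = 2 * b 0 ^ 2 + 2 * signSum (fun i => b i.succ) y ^ 2 := fun y => by
      simp only [signSum_cons]; push_cast; ring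
    rw [sum_signs_succ]
    simp_rw [e]
    rw [Finset.sum_add_distrib, Finset.sum_const, Finset.card_univ, nsmul_eq_mul, card_signs,
      ← Finset.mul_sum, ih, Fin.sum_univ_succ]
    ring

/-- Induction on the number of signs: summing over the first sign kills the odd powers, and the
cross term `6 b₀² σ` is exactly the one in `3 (b₀² + σ)²`. -/
theorem sum_signSum_pow_four_le {n : ℕ} (b : Fin n → ℝ) :
    ∑ y, signSum b y ^ 4 ≤ 2 ^ n * (3 * (∑ i, b i ^ 2) ^ 2) := by
  induction n with
  | zero => simp [signSum]
  | succ n ih =>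
    have e : ∀ y, signSum b (Fin.cons 1 y) ^ 4 + signSum b (Fin.cons (-1) y) ^ 4
        = 2 * b 0 ^ 4 + 12 * b 0 ^ 2 * signSum (fun i => b i.succ) y ^ 2
          + 2 * signSum (fun i => b i.succ) y ^ 4 := fun y => by
      simp only [signSum_cons]; push_cast; ring
    rw [sum_signs_succ]
    simp_rw [e]
    rw [Finset.sum_add_distrib, Finset.sum_add_distrib, Finset.sum_const, Finset.card_univ,
      nsmul_eq_mul, card_signs, ← Finset.mul_sum, ← Finset.mul_sum, sum_signSum_sq,
      Fin.sum_univ_succ]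
    have hi := ih fun i => b i.succ
    have hp : (0 : ℝ) ≤ 2 ^ n * b 0 ^ 4 := by positivity
    set σ := ∑ i : Fin n, b i.succ ^ 2
    rw [pow_succ (2 : ℝ) n]
    linarith

/-- The quadratic chaos `∑_{i<j} a i j y_i y_j`. -/
def signForm {n : ℕ} (a : Fin n → Fin n → ℝ) (y : Fin n → ℤˣ) : ℝ :=
  ∑ i, ∑ j, if i < j then a i j * (((y i : ℤ) : ℝ) * ((y j : ℤ) : ℝ)) else 0

/-- The sum of the squares of the coefficients of `signForm`. -/
def formEnergy {n : ℕ} (a : Fin n → Fin n → ℝ) : ℝ :=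
  ∑ i, ∑ j, if i < j then a i j ^ 2 else 0

theorem formEnergy_nonneg {n : ℕ} (a : Fin n → Fin n → ℝ) : 0 ≤ formEnergy a :=
  Finset.sum_nonneg fun i _ => Finset.sum_nonneg fun j _ => by split_ifs <;> positivity

theorem signForm_cons {n : ℕ} (a : Fin (n + 1) → Fin (n + 1) → ℝ) (u : ℤˣ) (y : Fin n → ℤˣ) :
    signForm a (Fin.cons u y) = ((u : ℤ) : ℝ) * signSum (fun j => a 0 j.succ) y
      + signForm (fun i j => a i.succ j.succ) y := by
  simp only [signForm, signSum, Fin.sum_univ_succ, Fin.cons_zero, Fin.cons_succ,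
    Fin.succ_lt_succ_iff, Fin.succ_pos, if_true, if_false, Fin.not_lt_zero, zero_add,
    Finset.mul_sum]
  congr 1
  exact Finset.sum_congr rfl fun j _ => by ring

theorem formEnergy_succ {n : ℕ} (a : Fin (n + 1) → Fin (n + 1) → ℝ) :
    formEnergy a = ∑ j : Fin n, a 0 j.succ ^ 2 + formEnergy fun i j => a i.succ j.succ := by
  simp [formEnergy, Fin.sum_univ_succ]

theorem sum_signForm {n : ℕ} (a : Fin n → Fin n → ℝ) : ∑ y, signForm a y = 0 := by
  induction n with
  | zero => simp [signForm]
  | succ n ih =>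
    have e : ∀ y, signForm a (Fin.cons 1 y) + signForm a (Fin.cons (-1) y)
        = 2 * signForm (fun i j => a i.succ j.succ) y := fun y => by
      simp only [signForm_cons]; push_cast; ring
    rw [sum_signs_succ]
    simp_rw [e]
    rw [← Finset.mul_sum, ih, mul_zero]

theorem sum_signForm_sq {n : ℕ} (a : Fin n → Fin n → ℝ) :
    ∑ y, signForm a y ^ 2 = 2 ^ n * formEnergy a := by
  induction n with
  | zero => simp [signForm, formEnergy]
  | succ n ih =>
    have e : ∀ y, signForm a (Fin.cons 1 y) ^ 2 + signForm a (Fin.cons (-1) y) ^ 2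
        = 2 * signSum (fun j => a 0 j.succ) y ^ 2
          + 2 * signForm (fun i j => a i.succ j.succ) y ^ 2 := fun y => by
      simp only [signForm_cons]; push_cast; ring
    rw [sum_signs_succ]
    simp_rw [e]
    rw [Finset.sum_add_distrib, ← Finset.mul_sum, ← Finset.mul_sum, ih, sum_signSum_sq,
      formEnergy_succ]
    ring

/-- Hypercontractivity for quadratic forms in signs. -/
theorem sum_signForm_pow_four_le {n : ℕ} (a : Fin n → Fin n → ℝ) :
    ∑ y, signForm a y ^ 4 ≤ 2 ^ n * (27 * formEnergy a ^ 2) := by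
  induction n with
  | zero => simp [signForm, formEnergy]
  | succ n ih =>
    set S := signSum (fun j => a 0 j.succ)
    set Q := signForm (fun i j => a i.succ j.succ)
    have e : ∀ y, signForm a (Fin.cons 1 y) ^ 4 + signForm a (Fin.cons (-1) y) ^ 4
        = 2 * S y ^ 4 + 12 * (S y ^ 2 * Q y ^ 2) + 2 * Q y ^ 4 := fun y => by
      simp only [signForm_cons]; push_cast; ring
    rw [sum_signs_succ]
    simp_rw [e]
    rw [Finset.sum_add_distrib, Finset.sum_add_distrib, ← Finset.mul_sum, ← Finset.mul_sum,
      ← Finset.mul_sum, formEnergy_succ]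
    have hQ := ih fun i j => a i.succ j.succ
    have hS := sum_signSum_pow_four_le fun j => a 0 j.succ
    have hv := formEnergy_nonneg fun i j => a (Fin.succ i) (Fin.succ j)
    have hσ : 0 ≤ ∑ j : Fin n, a 0 j.succ ^ 2 := Finset.sum_nonneg fun _ _ => sq_nonneg _
    set σ := ∑ j : Fin n, a 0 j.succ ^ 2
    set v := formEnergy fun i j => a (Fin.succ i) (Fin.succ j)
    -- By Cauchy–Schwarz the mixed moment is at most `√(3 · 27) σ v = 9 σ v`. The total `3σ² + 54σv
    -- + 27v²` then fits into `27 (σ + v)²`, which is why the constant `27` survives the induction.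
    have hcs : (∑ y, S y ^ 2 * Q y ^ 2) ≤ 2 ^ n * (9 * σ * v) := by
      refine le_of_sq_le_sq ?_ (by positivity)
      calc (∑ y, S y ^ 2 * Q y ^ 2) ^ 2 ≤ (∑ y, (S y ^ 2) ^ 2) * ∑ y, (Q y ^ 2) ^ 2 :=
            Finset.sum_mul_sq_le_sq_mul_sq _ _ _
        _ = (∑ y, S y ^ 4) * ∑ y, Q y ^ 4 := by simp_rw [← pow_mul]
        _ ≤ (2 ^ n * (3 * σ ^ 2)) * (2 ^ n * (27 * v ^ 2)) :=
            mul_le_mul hS hQ (Finset.sum_nonneg fun _ _ => by positivity) (by positivity)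
        _ = _ := by ring
    have h24 : 0 ≤ (2 : ℝ) ^ n * σ ^ 2 := by positivity
    rw [pow_succ (2 : ℝ) n]
    linarith

/-- The modulus of a characteristic function with small centred values, to fourth order. -/
theorem norm_sum_exp_le {V : Type*} [Fintype V] (w : V → ℝ) {N s q : ℝ} (hN : Fintype.card V = N)
    (hw : ∀ y, |w y| ≤ 1) (h1 : ∑ y, w y = 0) (h2 : ∑ y, w y ^ 2 = N * s)
    (h4 : ∑ y, w y ^ 4 ≤ N * q) (hs0 : 0 ≤ s) (hs : s ≤ 1 / 2) (hq : 0 ≤ q) :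
    ‖∑ y, Complex.exp (w y * Complex.I)‖ ≤ N * Real.exp (-(1 / 2) * s + 11 / 96 * q) := by
  have hN0 : 0 ≤ N := hN ▸ Nat.cast_nonneg _
  have hnorm : ‖∑ y, Complex.exp (w y * Complex.I)‖ ^ 2
      = (∑ y, Real.cos (w y)) ^ 2 + (∑ y, Real.sin (w y)) ^ 2 := by
    rw [← Complex.normSq_eq_norm_sq, Complex.normSq_apply, Complex.re_sum, Complex.im_sum]
    simp_rw [Complex.exp_ofReal_mul_I_re, Complex.exp_ofReal_mul_I_im]
    ring
  have hc0 : 0 ≤ ∑ y, Real.cos (w y) := by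
    refine Finset.sum_nonneg fun y _ => Real.cos_nonneg_of_mem_Icc ?_
    have := abs_le.1 (hw y)
    constructor <;> linarith [Real.pi_gt_three]
  have hc : ∑ y, Real.cos (w y) ≤ N * (1 - s / 2 + 5 / 96 * q) := by
    calc ∑ y, Real.cos (w y) ≤ ∑ y, (1 - w y ^ 2 / 2 + 5 / 96 * w y ^ 4) := by
          refine Finset.sum_le_sum fun y _ => ?_
          have := (abs_le.1 (Real.cos_bound (hw y))).2
          rw [Even.pow_abs (by decide : Even 4)] at this
          linarith
      _ = N - (N * s) / 2 + 5 / 96 * ∑ y, w y ^ 4 := by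
          rw [Finset.sum_add_distrib, Finset.sum_sub_distrib, ← Finset.sum_div, h2,
            ← Finset.mul_sum, Finset.sum_const, Finset.card_univ, nsmul_eq_mul, mul_one, hN]
      _ ≤ _ := by linarith
  -- As `w` has mean zero, `sin w` may be replaced by `sin w - w`, so the imaginary part enters the
  -- squared modulus only through fourth moments.
  have hsin : (∑ y, Real.sin (w y)) ^ 2 ≤ N ^ 2 * (q / 16) := by
    have hpt : ∀ y, (Real.sin (w y) - w y) ^ 2 ≤ w y ^ 4 / 16 := fun y => by
      have hb := abs_le.1 (Real.sin_bound (hw y))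
      have ha := hw y
      have ha0 := abs_nonneg (w y)
      have h5 : |w y| ^ 5 ≤ |w y| ^ 2 := pow_le_pow_of_le_one ha0 ha (by norm_num)
      have h3 : |w y| ^ 3 ≤ |w y| ^ 2 := pow_le_pow_of_le_one ha0 ha (by norm_num)
      have h3' := abs_le.1 (abs_pow (w y) 3).le
      have hle : |Real.sin (w y) - w y| ≤ |w y| ^ 2 / 4 := by
        rw [abs_le]; constructor <;> linarith
      calc (Real.sin (w y) - w y) ^ 2 = |Real.sin (w y) - w y| ^ 2 := (sq_abs _).symm
        _ ≤ (|w y| ^ 2 / 4) ^ 2 := by gcongr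
        _ = w y ^ 4 / 16 := by rw [sq_abs]; ring
    have e : ∑ y, Real.sin (w y) = ∑ y, (Real.sin (w y) - w y) := by
      rw [Finset.sum_sub_distrib, h1, sub_zero]
    rw [e]
    calc _ ≤ (Fintype.card V : ℝ) * ∑ y, (Real.sin (w y) - w y) ^ 2 := by
          simpa using sq_sum_le_card_mul_sum_sq (s := univ) (f := fun y => Real.sin (w y) - w y)
      _ ≤ N * ∑ y, w y ^ 4 / 16 := by rw [hN]; gcongr with y; exact hpt y
      _ ≤ N * (N * q / 16) := by rw [← Finset.sum_div]; gcongr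
      _ = _ := by ring
  have hes : Real.exp s ≤ 2 := by
    have := Real.exp_bound_div_one_sub_of_interval hs0 (by linarith)
    refine this.trans ?_
    rw [div_le_iff₀ (by linarith)]; linarith
  have hA : (1 - s / 2 + 5 / 96 * q) ^ 2 ≤ Real.exp (-s + 5 / 48 * q) := by
    have := Real.add_one_le_exp (-s / 2 + 5 / 96 * q)
    calc _ ≤ Real.exp (-s / 2 + 5 / 96 * q) ^ 2 :=
          pow_le_pow_left₀ (by linarith) (by linarith) 2
      _ = _ := by rw [← Real.exp_nat_mul]; congr 1; push_cast; ring
  -- Factoring out the exponential costs at most a factor `2`, because `s ≤ 1/2` gives `exp (-s) ≥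
  -- 1/2`. Then `1 + q/8 ≤ exp (q/8)`, and `5/48 + 1/8 = 11/48` is halved by the square root.
  have hB : q / 16 ≤ Real.exp (-s + 5 / 48 * q) * (q / 8) := by
    have h : 1 / 2 ≤ Real.exp (-s + 5 / 48 * q) := by
      calc (1 / 2 : ℝ) ≤ Real.exp (-s) := by
            rw [Real.exp_neg, one_div]
            exact inv_anti₀ (Real.exp_pos _) hes
        _ ≤ _ := Real.exp_le_exp.2 (by linarith)
    have := mul_le_mul_of_nonneg_right h (by linarith : 0 ≤ q / 8)
    linarith
  refine le_of_sq_le_sq ?_ (by positivity)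
  rw [hnorm]
  calc _ ≤ (N * (1 - s / 2 + 5 / 96 * q)) ^ 2 + N ^ 2 * (q / 16) := by gcongr
    _ = N ^ 2 * ((1 - s / 2 + 5 / 96 * q) ^ 2 + q / 16) := by ring
    _ ≤ N ^ 2 * (Real.exp (-s + 5 / 48 * q) + Real.exp (-s + 5 / 48 * q) * (q / 8)) := by gcongr
    _ = N ^ 2 * (Real.exp (-s + 5 / 48 * q) * (q / 8 + 1)) := by ring
    _ ≤ N ^ 2 * (Real.exp (-s + 5 / 48 * q) * Real.exp (q / 8)) := by
        gcongr; exact Real.add_one_le_exp _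
    _ = (N * Real.exp (-(1 / 2) * s + 11 / 96 * q)) ^ 2 := by
        rw [← Real.exp_add, mul_pow, ← Real.exp_nat_mul]; congr 2; push_cast; ring

end Moments

end PartialHadamard

namespace PartialHadamard

/-! ### Bounds for the characteristic function of an increment -/

section CharacterSums

open Finset

/-- The scalar product of `μ` with the increment determined by `y`. -/
def pairForm {n : ℕ} (μ : Pairs n → ℝ) (y : Fin n → ℤˣ) : ℝ :=
  ∑ p, μ p * (pairProducts y p : ℝ)

/-- The character `∏ (y_i y_j)^{m_{ij}}` of the group of sign vectors. -/
def pairChar {n : ℕ} (m : Pairs n → Fin 4) (y : Fin n → ℤˣ) : ℤˣ :=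
  ∏ p, (y p.1.1 * y p.1.2) ^ (m p : ℕ)

/-- Up to a phase and the factor `2 ^ n`, the characteristic function of an increment
at the point `(π/2) m + μ`. -/
noncomputable def charSum {n : ℕ} (m : Pairs n → Fin 4) (μ : Pairs n → ℝ) : ℂ :=
  ∑ y, ((pairChar m y : ℤ) : ℂ) * Complex.exp (pairForm μ y * Complex.I)

theorem sum_pairs {n : ℕ} (g : Fin n → Fin n → ℝ) :
    ∑ p : Pairs n, g p.1.1 p.1.2 = ∑ i, ∑ j, if i < j then g i j else 0 := by
  rw [← Fintype.sum_prod_type' (f := fun i j => if i < j then g i j else 0),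
    ← Finset.sum_filter (fun p : Fin n × Fin n => p.1 < p.2) fun p => g p.1 p.2]
  exact (Finset.sum_subtype _ (by simp) fun p : Fin n × Fin n => g p.1 p.2).symm

theorem card_pairs (n : ℕ) : Fintype.card (Pairs n) = dim n := by
  have h := sum_pairs (n := n) fun _ _ => 1
  have h2 : ∀ i : Fin n, (∑ j : Fin n, if i < j then (1 : ℝ) else 0) = ((n - 1 - i : ℕ) : ℝ) := by
    intro i
    rw [← Finset.sum_filter, Finset.sum_const, nsmul_eq_mul, mul_one]
    have : (univ.filter fun j => i < j) = Finset.Ioi i := by ext; simp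
    rw [this, Fin.card_Ioi]
  simp_rw [h2] at h
  rw [← Nat.cast_sum] at h
  simp only [Finset.sum_const, Finset.card_univ, nsmul_eq_mul, mul_one] at h
  have h' : Fintype.card (Pairs n) = ∑ i : Fin n, (n - 1 - i : ℕ) := by exact_mod_cast h
  rw [h', Fin.sum_univ_eq_sum_range (fun i => n - 1 - i), Finset.sum_range_reflect (fun i => i),
    Finset.sum_range_id, dim, Nat.choose_two_right]

open Classical in
/-- Extension of a vector indexed by pairs to a square array. -/
noncomputable def pairArray {n : ℕ} (μ : Pairs n → ℝ) (i j : Fin n) : ℝ :=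
  if h : i < j then μ ⟨(i, j), h⟩ else 0

theorem pairArray_apply {n : ℕ} (μ : Pairs n → ℝ) (p : Pairs n) :
    pairArray μ p.1.1 p.1.2 = μ p := by
  simp [pairArray, p.2]

theorem pairForm_eq_signForm {n : ℕ} (μ : Pairs n → ℝ) (y : Fin n → ℤˣ) :
    pairForm μ y = signForm (pairArray μ) y := by
  rw [signForm, ← sum_pairs, pairForm]
  refine Finset.sum_congr rfl fun p _ => ?_
  rw [pairArray_apply, pairProducts]
  push_cast
  rfl

theorem sum_sq_eq_formEnergy {n : ℕ} (μ : Pairs n → ℝ) :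
    ∑ p, μ p ^ 2 = formEnergy (pairArray μ) := by
  rw [formEnergy, ← sum_pairs fun i j => pairArray μ i j ^ 2]
  exact Finset.sum_congr rfl fun p _ => by rw [pairArray_apply]

theorem abs_units (u : ℤˣ) : |((u : ℤ) : ℝ)| = 1 := by
  rcases Int.units_eq_one_or u with rfl | rfl <;> simp

theorem abs_pairProducts {n : ℕ} (y : Fin n → ℤˣ) (p : Pairs n) :
    |(pairProducts y p : ℝ)| = 1 := by
  rw [pairProducts]; push_cast; rw [abs_mul, abs_units, abs_units, one_mul]

theorem abs_pairForm_le {n : ℕ} {μ : Pairs n → ℝ} {δ : ℝ} (hμ : ∀ p, |μ p| ≤ δ)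
    (y : Fin n → ℤˣ) : |pairForm μ y| ≤ dim n * δ := by
  calc |pairForm μ y| ≤ ∑ p, |μ p * (pairProducts y p : ℝ)| := Finset.abs_sum_le_sum_abs _ _
    _ ≤ ∑ _p : Pairs n, δ := Finset.sum_le_sum fun p _ => by
        rw [abs_mul, abs_pairProducts, mul_one]; exact hμ p
    _ = _ := by rw [Finset.sum_const, Finset.card_univ, card_pairs, nsmul_eq_mul]

theorem pairChar_mul {n : ℕ} (m : Pairs n → Fin 4) (y z : Fin n → ℤˣ) :
    pairChar m (y * z) = pairChar m y * pairChar m z := by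
  simp only [pairChar, ← Finset.prod_mul_distrib, Pi.mul_apply, ← mul_pow]
  exact Finset.prod_congr rfl fun p _ => by congr 1; exact mul_mul_mul_comm _ _ _ _

theorem normSq_add_sign_mul (u e : ℤˣ) (a b : ℝ) :
    ‖((u : ℤ) : ℂ) * Complex.exp (a * Complex.I)
      + (((u * e : ℤˣ) : ℤ) : ℂ) * Complex.exp (b * Complex.I)‖ ^ 2
      = 2 * (1 + ((e : ℤ) : ℝ) * Real.cos (a - b)) := by
  rw [← Complex.normSq_eq_norm_sq, Complex.normSq_apply]
  have ha := Real.sin_sq_add_cos_sq a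
  have hb := Real.sin_sq_add_cos_sq b
  rcases Int.units_eq_one_or u with rfl | rfl <;> rcases Int.units_eq_one_or e with rfl | rfl <;>
    simp only [Real.cos_sub, Complex.add_re, Complex.add_im, Units.val_neg, Units.val_one, one_mul,
      mul_one, mul_neg, neg_neg, neg_mul, Int.cast_one, Int.cast_neg, Complex.neg_re,
      Complex.neg_im, Complex.exp_ofReal_mul_I_re, Complex.exp_ofReal_mul_I_im] <;>
    linear_combination ha + hb

/-- Averaging over the flip `y ↦ y * z`. -/
theorem norm_charSum_sq_le {n : ℕ} (m : Pairs n → Fin 4) (μ : Pairs n → ℝ) (z : Fin n → ℤˣ) :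
    ‖charSum m μ‖ ^ 2 ≤ 2 ^ n * ∑ y : Fin n → ℤˣ,
      1 / 2 * (1 + ((pairChar m z : ℤ) : ℝ) * Real.cos (pairForm μ y - pairForm μ (y * z))) := by
  set f : (Fin n → ℤˣ) → ℂ := fun y =>
    ((pairChar m y : ℤ) : ℂ) * Complex.exp (pairForm μ y * Complex.I) with hf
  have e : 2 * charSum m μ = ∑ y, (f y + f (y * z)) := by
    have e0 := Equiv.sum_comp (Equiv.mulRight z) f
    simp only [Equiv.coe_mulRight] at e0
    rw [Finset.sum_add_distrib, e0, charSum]; ring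
  -- Cauchy–Schwarz over the `2 ^ n` sign vectors; each pair of unimodular terms then contributes `2
  -- (1 ± cos)`.
  have h : (2 * ‖charSum m μ‖) ^ 2 ≤ 2 ^ n * ∑ y, ‖f y + f (y * z)‖ ^ 2 := by
    have h2 : 2 * ‖charSum m μ‖ = ‖2 * charSum m μ‖ := by simp
    rw [h2, e]
    calc _ ≤ (∑ y, ‖f y + f (y * z)‖) ^ 2 := by gcongr; exact norm_sum_le _ _
      _ ≤ _ := by
        simpa using sq_sum_le_card_mul_sum_sq (s := univ) (f := fun y => ‖f y + f (y * z)‖)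
  simp_rw [hf, pairChar_mul, normSq_add_sign_mul] at h
  rw [← Finset.mul_sum] at h ⊢
  linarith

/-- The sign vector that flips the coordinate `k`. -/
def flip {n : ℕ} (k : Fin n) : Fin n → ℤˣ := fun i => if i = k then -1 else 1

/-- Differencing in two coordinates kills every monomial except the one containing both, which
isolates a single coefficient `μ p`. -/
theorem pairForm_second_difference {n : ℕ} (μ : Pairs n → ℝ) (p : Pairs n) (y : Fin n → ℤˣ) :
    (pairForm μ y - pairForm μ (y * flip p.1.1))
      - (pairForm μ (y * flip p.1.2) - pairForm μ (y * flip p.1.2 * flip p.1.1))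
      = 4 * μ p * (pairProducts y p : ℝ) := by
  simp only [pairForm, ← Finset.sum_sub_distrib]
  rw [Finset.sum_eq_single p]
  · have hne : p.1.1 ≠ p.1.2 := ne_of_lt p.2
    simp only [pairProducts, Pi.mul_apply, flip, hne, hne.symm, if_true, if_false]
    push_cast
    ring
  · rintro ⟨⟨i, j⟩, hij⟩ - hne
    obtain ⟨⟨k, l⟩, hkl⟩ := p
    simp only [ne_eq, Subtype.mk.injEq, Prod.mk.injEq] at hne hij hkl
    simp only [pairProducts, Pi.mul_apply, flip]
    by_cases h1 : i = k <;> by_cases h2 : j = k <;> by_cases h3 : i = l <;> by_cases h4 : j = l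
    all_goals first
      | (exfalso; omega)
      | (simp only [h1, h2, h3, h4, hkl.ne, hkl.ne', if_true, if_false]; push_cast; ring)
  · simp

/-- One large coordinate already forces decay, whatever the character. After flipping one endpoint
of `p`, pairing `y` with the flip of the other endpoint turns the cosines into a product containing
`cos (2 μ p)`. Their signed average is thus at most `cos 2δ`, and `(1 + cos 2δ)/2 = cos² δ`. -/
theorem norm_charSum_le_of_le {n : ℕ} (m : Pairs n → Fin 4) {μ : Pairs n → ℝ} {δ : ℝ}
    (hδ0 : 0 ≤ δ) (hδ1 : δ ≤ 4 / 5) {p : Pairs n} (hp : δ ≤ |μ p|)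
    (hp' : |μ p| ≤ Real.pi / 4) :
    ‖charSum m μ‖ ≤ 2 ^ n * Real.exp (-(11 / 24) * δ ^ 2) := by
  have h := norm_charSum_sq_le m μ (flip p.1.1)
  set D : (Fin n → ℤˣ) → ℝ := fun y => pairForm μ y - pairForm μ (y * flip p.1.1)
  set ε : ℝ := ((pairChar m (flip p.1.1) : ℤ) : ℝ)
  have hε : |ε| = 1 := abs_units _
  have hcos2 : 0 ≤ Real.cos (2 * μ p) :=
    Real.cos_nonneg_of_mem_Icc (by have := abs_le.1 hp'; constructor <;> linarith)
  have hcosδ : Real.cos (2 * μ p) ≤ Real.cos (2 * δ) := by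
    rw [← Real.cos_abs, abs_mul, abs_two]
    exact Real.cos_le_cos_of_nonneg_of_le_pi (by linarith) (by linarith [Real.pi_pos])
      (by linarith)
  have hD : ∀ y, ε * Real.cos (D y) + ε * Real.cos (D (y * flip p.1.2)) ≤
      2 * Real.cos (2 * δ) := by
    intro y
    have hd : D y - D (y * flip p.1.2) = 4 * μ p * (pairProducts y p : ℝ) :=
      pairForm_second_difference μ p y
    have hc : Real.cos ((D y - D (y * flip p.1.2)) / 2) = Real.cos (2 * μ p) := by
      rw [hd, ← Real.cos_abs, ← Real.cos_abs (2 * μ p)]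
      congr 1
      rw [mul_div_right_comm, abs_mul, abs_pairProducts, mul_one]
      congr 1; ring
    rw [← mul_add, Real.cos_add_cos, hc]
    calc _ ≤ |ε * (2 * Real.cos ((D y + D (y * flip p.1.2)) / 2) * Real.cos (2 * μ p))| :=
          le_abs_self _
      _ = 2 * |Real.cos ((D y + D (y * flip p.1.2)) / 2)| * Real.cos (2 * μ p) := by
          rw [abs_mul, hε, one_mul, abs_mul, abs_mul, abs_two, abs_of_nonneg hcos2]
      _ ≤ 2 * 1 * Real.cos (2 * δ) := by
          gcongr
          exact Real.abs_cos_le_one _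
      _ = _ := by ring
  have hsum : ∑ y, ε * Real.cos (D y) ≤ 2 ^ n * Real.cos (2 * δ) := by
    have e := Equiv.sum_comp (Equiv.mulRight (flip p.1.2)) fun y => ε * Real.cos (D y)
    have : ∑ y, (ε * Real.cos (D y) + ε * Real.cos (D (y * flip p.1.2)))
        ≤ ∑ _y : Fin n → ℤˣ, 2 * Real.cos (2 * δ) := Finset.sum_le_sum fun y _ => hD y
    rw [Finset.sum_add_distrib, Finset.sum_const, Finset.card_univ, nsmul_eq_mul,
      card_signs] at this
    simp only [Equiv.coe_mulRight] at e
    linarith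
  -- From `cos δ ≤ 1 - δ²/2 + (5/96) δ⁴` and `δ² ≤ 4/5`, the quartic term is at most `δ²/24`; hence
  -- the constant `1/2 - 1/24 = 11/24`.
  have hcb : Real.cos δ ≤ Real.exp (-(11 / 24) * δ ^ 2) := by
    have hb := (abs_le.1 (Real.cos_bound (x := δ) (by rw [abs_of_nonneg hδ0]; linarith))).2
    rw [abs_of_nonneg hδ0] at hb
    have h2 : δ ^ 2 ≤ 4 / 5 := by nlinarith
    have h4 : δ ^ 4 ≤ 4 / 5 * δ ^ 2 := by nlinarith [sq_nonneg δ]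
    have := Real.add_one_le_exp (-(11 / 24) * δ ^ 2)
    linarith
  have hc0 : 0 ≤ Real.cos δ :=
    Real.cos_nonneg_of_mem_Icc (by constructor <;> linarith [Real.pi_gt_three])
  refine (le_of_sq_le_sq ?_ (by positivity)).trans
    (mul_le_mul_of_nonneg_left hcb (by positivity))
  refine h.trans ?_
  have e : ∑ y : Fin n → ℤˣ, 1 / 2 * (1 + ε * Real.cos (D y))
      = 1 / 2 * (2 ^ n + ∑ y, ε * Real.cos (D y)) := by
    rw [← Finset.mul_sum, Finset.sum_add_distrib, Finset.sum_const, Finset.card_univ,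
      nsmul_eq_mul, card_signs, mul_one]
  rw [e, mul_pow, sq (2 ^ n), mul_assoc]
  refine mul_le_mul_of_nonneg_left ?_ (by positivity)
  rw [Real.cos_two_mul] at hsum
  linarith

/-- In the small box the phases hardly vary, so `y` and `y * z` nearly cancel when the character
takes the value `-1` at `z`. -/
theorem norm_charSum_le_of_ne_one {n : ℕ} {m : Pairs n → Fin 4} {μ : Pairs n → ℝ} {δ : ℝ}
    (hδ0 : 0 ≤ δ) (hδ : dim n * δ ≤ 1 / 4) (hδ1 : δ ≤ 4 / 5) (hμ : ∀ p, |μ p| ≤ δ)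
    {z : Fin n → ℤˣ} (hz : pairChar m z ≠ 1) :
    ‖charSum m μ‖ ≤ 2 ^ n * Real.exp (-(11 / 24) * δ ^ 2) := by
  have hz' : pairChar m z = -1 := (Int.units_eq_one_or _).resolve_left hz
  have h := norm_charSum_sq_le m μ z
  have hb : ∀ y, 1 / 2 * (1 + ((pairChar m z : ℤ) : ℝ)
      * Real.cos (pairForm μ y - pairForm μ (y * z))) ≤ 1 / 4 := by
    intro y
    have h1 := abs_le.1 (abs_pairForm_le hμ y)
    have h2 := abs_le.1 (abs_pairForm_le hμ (y * z))
    have hc := Real.one_sub_sq_div_two_le_cos (x := pairForm μ y - pairForm μ (y * z))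
    have hsq : (pairForm μ y - pairForm μ (y * z)) ^ 2 ≤ (1 / 2) ^ 2 := 
      sq_le_sq' (by linarith) (by linarith)
    rw [hz']
    push_cast
    linarith
  have he : 1 / 2 ≤ Real.exp (-(11 / 24) * δ ^ 2) := by
    have := Real.add_one_le_exp (-(11 / 24) * δ ^ 2)
    nlinarith
  refine (le_of_sq_le_sq ?_ (by positivity)).trans
    (mul_le_mul_of_nonneg_left he (by positivity))
  calc _ ≤ _ := h
    _ ≤ 2 ^ n * ∑ _y : Fin n → ℤˣ, (1 / 4 : ℝ) := by gcongr with y; exact hb y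
    _ = _ := by
      rw [Finset.sum_const, Finset.card_univ, nsmul_eq_mul, card_signs]; ring

/-- With trivial character the sum is that of a centred quadratic form of variance `∑ μ²` and fourth
moment at most `27 (∑ μ²)²`. Since `∑ μ² ≤ (nδ)²/2`, the quartic error has coefficient
`(11/96)(27/4) < 1`. -/
theorem norm_charSum_le_gaussian {n : ℕ} {m : Pairs n → Fin 4} {μ : Pairs n → ℝ} {δ : ℝ}
    (hδ : dim n * δ ≤ 1 / 4) (hδ1 : δ ≤ 4 / 5) (hμ : ∀ p, |μ p| ≤ δ)
    (hm : ∀ z, pairChar m z = 1) :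
    ‖charSum m μ‖ ≤ 2 ^ n * Real.exp (-(1 / 2) * ∑ p, μ p ^ 2 + (n * δ) ^ 4) := by
  -- Without pairs, `hμ` is vacuous and does not force `δ ≥ 0`.
  rcases isEmpty_or_nonempty (Pairs n) with hemp | ⟨⟨p₀⟩⟩
  · have : charSum m μ = 2 ^ n := by simp [charSum, hm, pairForm]
    rw [this]
    simp only [norm_pow, Complex.norm_ofNat, Finset.univ_eq_empty, Finset.sum_empty, mul_zero,
      zero_add]
    exact le_mul_of_one_le_right (by positivity)
      (Real.one_le_exp (Even.pow_nonneg (by decide) _))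
  have hδ0 : 0 ≤ δ := (abs_nonneg _).trans (hμ p₀)
  have hs : ∑ p, μ p ^ 2 ≤ dim n * δ ^ 2 := by
    calc _ ≤ ∑ _p : Pairs n, δ ^ 2 := Finset.sum_le_sum fun p _ => by
          rw [← sq_abs]; exact pow_le_pow_left₀ (abs_nonneg _) (hμ p) 2
      _ = _ := by rw [Finset.sum_const, Finset.card_univ, card_pairs, nsmul_eq_mul]
  have hs0 : 0 ≤ ∑ p, μ p ^ 2 := Finset.sum_nonneg fun _ _ => sq_nonneg _
  have hs1 : ∑ p, μ p ^ 2 ≤ 1 / 2 := by nlinarith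
  have hsn : ∑ p, μ p ^ 2 ≤ (n * δ) ^ 2 / 2 := by
    refine hs.trans ?_
    have := mul_le_mul_of_nonneg_right (dim_le_sq n) (sq_nonneg δ)
    linarith
  have hw : charSum m μ = ∑ y, Complex.exp (pairForm μ y * Complex.I) := by
    simp [charSum, hm]
  have h := norm_sum_exp_le (pairForm μ) (card_signs n)
    (fun y => (abs_pairForm_le hμ y).trans (by linarith))
    (by simp_rw [pairForm_eq_signForm]; exact sum_signForm _)
    (by simp_rw [pairForm_eq_signForm]; exact sum_signForm_sq _)
    (by simp_rw [pairForm_eq_signForm]; exact sum_signForm_pow_four_le _)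
    (formEnergy_nonneg _) (by rwa [← sum_sq_eq_formEnergy]) (by positivity)
  rw [← sum_sq_eq_formEnergy] at h
  rw [hw]
  refine h.trans ?_
  gcongr
  have : (∑ p, μ p ^ 2) ^ 2 ≤ ((n * δ) ^ 2 / 2) ^ 2 := pow_le_pow_left₀ hs0 hsn 2
  have h4 : 0 ≤ (n * δ) ^ 4 := by positivity
  nlinarith

open Classical in
/-- The number of `m` with trivial character. -/
theorem card_trivial_pairChar_mul_le {n : ℕ} (hn : 0 < n) :
    (univ.filter fun m : Pairs n → Fin 4 => ∀ z, pairChar m z = 1).card * 2 ^ n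
      ≤ 2 * 4 ^ dim n := by
  -- Orthogonality of characters: the double sum over `m` and `y` detects the trivial characters.
  -- Summed over `m` first, it factors over the pairs, and `1 - 1 + 1 - 1 = 0` leaves only the
  -- constant sign vectors.
  have key : ∀ m : Pairs n → Fin 4, (∑ y, (pairChar m y : ℤ))
      = if ∀ z, pairChar m z = 1 then 2 ^ n else 0 := by
    intro m
    split_ifs with h
    · simp [h]
    · push Not at h
      obtain ⟨z, hz⟩ := h
      have hz' : pairChar m z = -1 := (Int.units_eq_one_or _).resolve_left hz
      have e := Equiv.sum_comp (Equiv.mulRight z) fun y => (pairChar m y : ℤ)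
      simp only [Equiv.coe_mulRight, pairChar_mul, hz', mul_neg, mul_one, Units.val_neg,
        Finset.sum_neg_distrib] at e
      omega
  have hsum : ∑ m : Pairs n → Fin 4, ∑ y, (pairChar m y : ℤ)
      = (univ.filter fun m : Pairs n → Fin 4 => ∀ z, pairChar m z = 1).card * 2 ^ n := by
    simp_rw [key]
    rw [← Finset.sum_filter, Finset.sum_const, nsmul_eq_mul]
  have hprod : ∀ y : Fin n → ℤˣ, ∑ m : Pairs n → Fin 4, (pairChar m y : ℤ)
      = ∏ p : Pairs n, if y p.1.1 = y p.1.2 then 4 else 0 := by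
    intro y
    have h := Finset.prod_univ_sum (fun _ : Pairs n => (univ : Finset (Fin 4)))
      fun p a => (((y p.1.1 * y p.1.2) ^ (a : ℕ) : ℤˣ) : ℤ)
    rw [Fintype.piFinset_univ] at h
    simp only [pairChar, Units.coe_prod]
    rw [← h]
    refine Finset.prod_congr rfl fun p _ => ?_
    generalize y p.1.1 = u
    generalize y p.1.2 = v
    revert u v
    decide
  have hzero : ∀ y : Fin n → ℤˣ, y ∉ univ.image (Function.const (Fin n) : ℤˣ → Fin n → ℤˣ) →
      (∏ p : Pairs n, if y p.1.1 = y p.1.2 then (4 : ℤ) else 0) = 0 := by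
    intro y hy
    by_contra hne
    refine hy (Finset.mem_image.2 ⟨y ⟨0, hn⟩, mem_univ _, funext fun i => ?_⟩)
    have hne := Finset.prod_ne_zero_iff.1 hne
    rcases Nat.eq_zero_or_pos i with h | h
    · exact congrArg y (Fin.ext h.symm)
    · have := hne ⟨(⟨0, hn⟩, i), h⟩ (mem_univ _)
      by_contra hc
      exact this (if_neg hc)
  have hfin : ((univ.filter fun m : Pairs n → Fin 4 => ∀ z, pairChar m z = 1).card * 2 ^ n : ℤ)
      ≤ 2 * 4 ^ dim n := by
    rw [← hsum, Finset.sum_comm]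
    simp_rw [hprod]
    rw [← Finset.sum_subset (Finset.subset_univ
      (univ.image (Function.const (Fin n) : ℤˣ → Fin n → ℤˣ))) fun y _ hy => hzero y hy]
    calc _ ≤ ∑ _y ∈ univ.image (Function.const (Fin n) : ℤˣ → Fin n → ℤˣ), (4 : ℤ) ^ dim n := by
          refine Finset.sum_le_sum fun y _ => ?_
          rw [← card_pairs, ← Finset.card_univ, ← Finset.prod_const]
          exact Finset.prod_le_prod (fun p _ => by split_ifs <;> norm_num)
            fun p _ => by split_ifs <;> norm_num
      _ ≤ _ := by
          rw [Finset.sum_const, nsmul_eq_mul]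
          gcongr
          exact_mod_cast Finset.card_image_le.trans (by decide : (univ : Finset ℤˣ).card ≤ 2)
  exact_mod_cast hfin

end CharacterSums

end PartialHadamard

namespace PartialHadamard

/-! ### Fourier inversion and the upper bound for the count -/

section FourierInversion

open Finset MeasureTheory

/-- The character `x ↦ e^{i k x}` of the circle at the point `(π/2) a + x`. -/
noncomputable def quarterKernel (a : Fin 4) (k : ℤ) (x : ℝ) : ℂ :=
  Complex.exp ((Real.pi / 2 * (a : ℕ) + x) * k * Complex.I)

theorem continuous_quarterKernel (a : Fin 4) (k : ℤ) : Continuous (quarterKernel a k) := by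
  unfold quarterKernel; fun_prop

theorem quarterKernel_sum {ι : Type*} (s : Finset ι) (a : Fin 4) (k : ι → ℤ) (x : ℝ) :
    quarterKernel a (∑ c ∈ s, k c) x = ∏ c ∈ s, quarterKernel a (k c) x := by
  simp only [quarterKernel]
  rw [← Complex.exp_sum]
  push_cast
  rw [Finset.mul_sum, Finset.sum_mul]

theorem quarterKernel_unit (a : Fin 4) (u : ℤˣ) (x : ℝ) :
    quarterKernel a u x
      = Complex.I ^ (a : ℕ) * ((u : ℤ) : ℂ) ^ (a : ℕ) * Complex.exp (x * ((u : ℤ) : ℝ) * Complex.I) := by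
  have h : Complex.exp (Real.pi / 2 * ((u : ℤ) : ℂ) * Complex.I) = Complex.I * ((u : ℤ) : ℂ) := by
    rcases Int.units_eq_one_or u with rfl | rfl
    · simp
    · have : (Real.pi / 2 * (((-1 : ℤˣ) : ℤ) : ℂ)) = -Real.pi / 2 := by push_cast; ring
      rw [this, Complex.exp_neg_pi_div_two_mul_I]
      simp
  rw [← mul_pow, ← h, ← Complex.exp_nat_mul, ← Complex.exp_add, quarterKernel]
  congr 1
  push_cast
  ring

/-- The four arcs of half-width `π/4` centred at multiples of `π/2` tile the circle. -/
theorem sum_integral_quarterKernel (k : ℤ) :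
    ∑ a, ∫ x in Set.Icc (-(Real.pi / 4)) (Real.pi / 4), quarterKernel a k x
      = if k = 0 then (2 * Real.pi : ℂ) else 0 := by
  have hpi := Real.pi_pos
  split_ifs with hk
  · subst hk
    have h : (0 : ℝ) ≤ Real.pi / 4 + Real.pi / 4 := by linarith
    simp [quarterKernel, Measure.real, ENNReal.toReal_ofReal h]
    ring
  · have hk' : (k : ℂ) * Complex.I ≠ 0 := mul_ne_zero (by exact_mod_cast hk) Complex.I_ne_zero
    set z := Complex.exp (Real.pi / 2 * (k * Complex.I)) with hz
    have hz4 : z ^ 4 = 1 := by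
      rw [hz, ← Complex.exp_nat_mul, Complex.exp_eq_one_iff]
      exact ⟨k, by push_cast; ring⟩
    have e : ∀ a : Fin 4, ∫ x in Set.Icc (-(Real.pi / 4)) (Real.pi / 4), quarterKernel a k x
        = z ^ (a : ℕ) * (Complex.exp (-(Real.pi / 4) * (k * Complex.I)) * (z - 1)
          / (k * Complex.I)) := by
      intro a
      rw [integral_Icc_eq_integral_Ioc, ← intervalIntegral.integral_of_le (by linarith)]
      have : ∀ x : ℝ, quarterKernel a k x = z ^ (a : ℕ) * Complex.exp (k * Complex.I * x) := by
        intro x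
        rw [hz, ← Complex.exp_nat_mul, ← Complex.exp_add, quarterKernel]
        congr 1; ring
      simp_rw [this]
      rw [intervalIntegral.integral_const_mul, integral_exp_mul_complex hk', mul_sub_one, hz,
        ← Complex.exp_add]
      congr 3
      · congr 1; push_cast; ring
      · congr 1; push_cast; ring
    simp_rw [e]
    rw [← Finset.sum_mul, Fin.sum_univ_four]
    -- The factor `z - 1` comes from the arc integral, so the case `z = 1` needs no separate
    -- treatment.
    have : (∑ i ∈ range 4, z ^ i) * (z - 1) = 0 := by rw [geom_sum_mul, hz4, sub_self]
    simp only [Finset.sum_range_succ, Finset.sum_range_zero, zero_add] at this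
    rw [← mul_div_assoc, div_eq_zero_iff]
    left
    simp only [Fin.val_zero, Fin.val_one, Fin.val_two, show ((3 : Fin 4) : ℕ) = 3 from rfl]
    linear_combination Complex.exp (-(Real.pi / 4) * (k * Complex.I)) * this

/-- The cube of half-width `π/4` about the origin. -/
def quarterCube (n : ℕ) : Set (Pairs n → ℝ) :=
  Set.univ.pi fun _ => Set.Icc (-(Real.pi / 4)) (Real.pi / 4)

theorem isCompact_quarterCube (n : ℕ) : IsCompact (quarterCube n) :=
  isCompact_univ_pi fun _ => isCompact_Icc

theorem volume_quarterCube (n : ℕ) : volume.real (quarterCube n) = (Real.pi / 2) ^ dim n := by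
  have hpi := Real.pi_pos
  rw [Measure.real, quarterCube, volume_pi_pi]
  simp only [Real.volume_Icc]
  rw [Finset.prod_const, Finset.card_univ, card_pairs, ENNReal.toReal_pow,
    ENNReal.toReal_ofReal (by linarith)]
  congr 1; ring

theorem sum_integral_prod_quarterKernel {n : ℕ} (k : Pairs n → ℤ) :
    ∑ m : Pairs n → Fin 4, ∫ μ in quarterCube n, ∏ p, quarterKernel (m p) (k p) (μ p)
      = if k = 0 then (2 * Real.pi : ℂ) ^ dim n else 0 := by
  have h : ∀ m : Pairs n → Fin 4, ∫ μ in quarterCube n, ∏ p, quarterKernel (m p) (k p) (μ p)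
      = ∏ p, ∫ x in Set.Icc (-(Real.pi / 4)) (Real.pi / 4), quarterKernel (m p) (k p) x := by
    intro m
    rw [quarterCube, volume_pi, Measure.restrict_pi_pi]
    exact integral_fintype_prod_eq_prod fun p x => quarterKernel (m p) (k p) x
  simp_rw [h]
  have hp := Finset.prod_univ_sum (fun _ : Pairs n => (univ : Finset (Fin 4)))
    fun p a => ∫ x in Set.Icc (-(Real.pi / 4)) (Real.pi / 4), quarterKernel a (k p) x
  rw [Fintype.piFinset_univ] at hp
  rw [← hp]
  simp_rw [sum_integral_quarterKernel]
  split_ifs with hk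
  · subst hk
    simp [card_pairs]
  · obtain ⟨p, hp⟩ := Function.ne_iff.1 hk
    exact Finset.prod_eq_zero (mem_univ p) (if_neg hp)

/-- Each pair contributes the phase `I ^ m p` independently of `y`, since `exp (iπu/2) = i u` for a
sign `u`. -/
theorem norm_sum_prod_quarterKernel {n : ℕ} (m : Pairs n → Fin 4) (μ : Pairs n → ℝ) :
    ‖∑ y, ∏ p, quarterKernel (m p) (pairProducts y p) (μ p)‖ = ‖charSum m μ‖ := by
  have h : ∑ y, ∏ p, quarterKernel (m p) (pairProducts y p) (μ p)
      = Complex.I ^ (∑ p, (m p : ℕ)) * charSum m μ := by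
    rw [charSum, Finset.mul_sum]
    refine Finset.sum_congr rfl fun y _ => ?_
    have e : ∀ p, quarterKernel (m p) (pairProducts y p) (μ p)
        = Complex.I ^ (m p : ℕ) * (((y p.1.1 * y p.1.2 : ℤˣ) : ℤ) : ℂ) ^ (m p : ℕ)
          * Complex.exp (μ p * (pairProducts y p : ℝ) * Complex.I) := fun p => by
      rw [show pairProducts y p = ((y p.1.1 * y p.1.2 : ℤˣ) : ℤ) by simp [pairProducts]]
      exact quarterKernel_unit _ _ _
    simp_rw [e]
    rw [Finset.prod_mul_distrib, Finset.prod_mul_distrib, Finset.prod_pow_eq_pow_sum, mul_assoc,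
      ← Complex.exp_sum, ← Finset.sum_mul]
    congr 2
    · rw [pairChar]; push_cast; rfl
    · rw [pairForm]; push_cast; rfl
  rw [h, norm_mul, norm_pow, Complex.norm_I, one_pow, one_mul]

open Classical in
theorem count_eq_card (n t : ℕ) :
    count n t = (univ.filter fun Y : Fin t → Fin n → ℤˣ => ∑ c, pairProducts (Y c) = 0).card := by
  set Φ : (Fin t → Fin n → ℤˣ) → Matrix (Fin n) (Fin t) ℤ := fun Y i j => (Y j i : ℤ)
  have hΦ : Function.Injective Φ := fun Y Y' h => by
    funext j i
    exact Units.ext (congrFun (congrFun h i) j)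
  have himg : {H : Matrix (Fin n) (Fin t) ℤ | IsPartialHadamard H}
      = Φ '' {Y | ∑ c, pairProducts (Y c) = 0} := by
    ext H
    simp only [Set.mem_ofPred_eq, Set.mem_image]
    constructor
    · intro hH
      obtain ⟨Y, hY, h0⟩ := hH.exists_signs
      exact ⟨Y, h0, Matrix.ext hY⟩
    · rintro ⟨Y, hY, rfl⟩
      have hlt : ∀ i j, i < j → Φ Y i ⬝ᵥ Φ Y j = 0 := fun i j hij => by
        have := congrFun hY ⟨(i, j), hij⟩
        simpa [pairProducts, dotProduct, Finset.sum_apply, Φ] using this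
      refine ⟨fun i j => Int.isUnit_iff.1 (Y j i).isUnit, fun i j hij => ?_⟩
      rcases lt_or_gt_of_ne hij with h | h
      · exact hlt i j h
      · rw [dotProduct_comm]; exact hlt j i h
  rw [count, himg, Set.ncard_image_of_injective _ hΦ, Set.ncard_eq_toFinset_card']
  congr 1
  ext; simp

/-- Fourier inversion for the number of partial Hadamard matrices. -/
theorem count_mul_two_pi_pow (n t : ℕ) :
    (count n t : ℂ) * (2 * Real.pi) ^ dim n = ∑ m : Pairs n → Fin 4, ∫ μ in quarterCube n,
      (∑ y, ∏ p, quarterKernel (m p) (pairProducts y p) (μ p)) ^ t := by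
  classical
  have hcont : ∀ (m : Pairs n → Fin 4) (Y : Fin t → Fin n → ℤˣ), IntegrableOn
      (fun μ : Pairs n → ℝ => ∏ p, quarterKernel (m p) ((∑ c, pairProducts (Y c)) p) (μ p))
      (quarterCube n) := fun m Y => by
    refine ContinuousOn.integrableOn_compact (isCompact_quarterCube n) (Continuous.continuousOn ?_)
    exact continuous_finsetProd _ fun p _ =>
      (continuous_quarterKernel _ _).comp (continuous_apply p)
  -- Expanding the power runs over all choices of `t` columns; the kernel turns sums of increments
  -- into products.
  have hpow : ∀ (m : Pairs n → Fin 4) (μ : Pairs n → ℝ),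
      (∑ y, ∏ p, quarterKernel (m p) (pairProducts y p) (μ p)) ^ t
      = ∑ Y : Fin t → Fin n → ℤˣ,
          ∏ p, quarterKernel (m p) ((∑ c, pairProducts (Y c)) p) (μ p) := by
    intro m μ
    rw [Finset.sum_pow', Fintype.piFinset_univ]
    refine Finset.sum_congr rfl fun Y _ => ?_
    rw [Finset.prod_comm]
    refine Finset.prod_congr rfl fun p _ => ?_
    rw [Finset.sum_apply, quarterKernel_sum]
  simp_rw [hpow]
  have hint : ∀ m : Pairs n → Fin 4, ∫ μ in quarterCube n, ∑ Y : Fin t → Fin n → ℤˣ,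
      ∏ p, quarterKernel (m p) ((∑ c, pairProducts (Y c)) p) (μ p)
      = ∑ Y : Fin t → Fin n → ℤˣ, ∫ μ in quarterCube n,
        ∏ p, quarterKernel (m p) ((∑ c, pairProducts (Y c)) p) (μ p) := fun m =>
    integral_finsetSum _ fun Y _ => hcont m Y
  simp_rw [hint]
  rw [Finset.sum_comm]
  simp_rw [sum_integral_prod_quarterKernel]
  rw [← Finset.sum_filter, Finset.sum_const, nsmul_eq_mul, count_eq_card]

theorem continuous_charSum {n : ℕ} (m : Pairs n → Fin 4) : Continuous (charSum m) := by
  unfold charSum pairForm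
  fun_prop

theorem count_mul_two_pi_pow_le (n t : ℕ) :
    (count n t : ℝ) * (2 * Real.pi) ^ dim n
      ≤ ∑ m : Pairs n → Fin 4, ∫ μ in quarterCube n, ‖charSum m μ‖ ^ t := by
  have h := congrArg norm (count_mul_two_pi_pow n t)
  have hl : ‖(count n t : ℂ) * (2 * Real.pi) ^ dim n‖ = count n t * (2 * Real.pi) ^ dim n := by
    rw [norm_mul, norm_pow, norm_mul, Complex.norm_natCast, Complex.norm_real, Complex.norm_ofNat,
      Real.norm_of_nonneg Real.pi_pos.le]
  rw [← hl, h]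
  refine (norm_sum_le _ _).trans (Finset.sum_le_sum fun m _ => ?_)
  refine (norm_integral_le_integral_norm _).trans_eq ?_
  simp_rw [norm_pow, norm_sum_prod_quarterKernel]

theorem integral_exp_neg_mul_sum_sq {ι : Type*} [Fintype ι] {b : ℝ} (hb : 0 < b) :
    ∫ μ : ι → ℝ, Real.exp (-b * ∑ p, μ p ^ 2) = (Real.pi / b) ^ ((Fintype.card ι : ℝ) / 2)
      ∧ Integrable fun μ : ι → ℝ => Real.exp (-b * ∑ p, μ p ^ 2) := by
  have e : ∀ μ : ι → ℝ, Real.exp (-b * ∑ p, μ p ^ 2) = ∏ p, Real.exp (-b * μ p ^ 2) := fun μ => by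
    rw [Finset.mul_sum, Real.exp_sum]
  simp_rw [e]
  constructor
  · rw [integral_fintype_prod_volume_eq_prod fun (_ : ι) x => Real.exp (-b * x ^ 2)]
    simp_rw [integral_gaussian]
    rw [Finset.prod_const, Finset.card_univ, Real.sqrt_eq_rpow, ← Real.rpow_natCast,
      ← Real.rpow_mul (by positivity)]
    congr 1; ring
  · exact Integrable.fintype_prod fun _ => integrable_exp_neg_mul_sq hb

open Classical in
-- A single majorant for all regimes, so that it can be integrated over each cube without splitting
-- the domain.
theorem norm_charSum_pow_le {n t : ℕ} {δ : ℝ} (hδ0 : 0 ≤ δ) (hδ : dim n * δ ≤ 1 / 4)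
    (hδ1 : δ ≤ 1 / 4) (m : Pairs n → Fin 4) {μ : Pairs n → ℝ} (hμ : μ ∈ quarterCube n) :
    ‖charSum m μ‖ ^ t ≤ 2 ^ (n * t) * (Real.exp (-(11 / 24) * (t * δ ^ 2))
      + if ∀ z, pairChar m z = 1 then
          Real.exp (t * (n * δ) ^ 4) * Real.exp (-(t / 2) * ∑ p, μ p ^ 2) else 0) := by
  have hμ' : ∀ p, |μ p| ≤ Real.pi / 4 := fun p => abs_le.2 (hμ p (Set.mem_univ p))
  have h0 : 0 ≤ if ∀ z, pairChar m z = 1 then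
      Real.exp (t * (n * δ) ^ 4) * Real.exp (-(t / 2) * ∑ p, μ p ^ 2) else 0 := by
    split_ifs <;> positivity
  have hfar : ‖charSum m μ‖ ≤ 2 ^ n * Real.exp (-(11 / 24) * δ ^ 2) →
      ‖charSum m μ‖ ^ t ≤ 2 ^ (n * t) * Real.exp (-(11 / 24) * (t * δ ^ 2)) := fun h => by
    calc _ ≤ (2 ^ n * Real.exp (-(11 / 24) * δ ^ 2)) ^ t := by gcongr
      _ = _ := by
        rw [mul_pow, ← pow_mul, ← Real.exp_nat_mul]; congr 2; ring
  have h2 : (0 : ℝ) ≤ 2 ^ (n * t) := by positivity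
  by_cases hbox : ∀ p, |μ p| ≤ δ
  · split_ifs at h0 ⊢ with hm
    · have h := norm_charSum_le_gaussian hδ (by linarith) hbox hm
      calc _ ≤ (2 ^ n * Real.exp (-(1 / 2) * ∑ p, μ p ^ 2 + (n * δ) ^ 4)) ^ t := by gcongr
        _ = 2 ^ (n * t) * (Real.exp (t * (n * δ) ^ 4) * Real.exp (-(t / 2) * ∑ p, μ p ^ 2)) := by
          rw [mul_pow, ← pow_mul, ← Real.exp_nat_mul, ← Real.exp_add]; congr 2; ring
        _ ≤ _ := mul_le_mul_of_nonneg_left (le_add_of_nonneg_left (Real.exp_nonneg _)) h2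
    · push Not at hm
      obtain ⟨z, hz⟩ := hm
      rw [add_zero]
      exact hfar (norm_charSum_le_of_ne_one hδ0 hδ (by linarith) hbox hz)
  · push Not at hbox
    obtain ⟨p, hp⟩ := hbox
    exact (hfar (norm_charSum_le_of_le m hδ0 (by linarith) hp.le (hμ' p))).trans
      (mul_le_mul_of_nonneg_left (le_add_of_nonneg_right h0) h2)

/-- The constant part integrates to `4 ^ d (π/2) ^ d = (2π) ^ d` over all cubes. The Gaussian part
is extended to the whole space and counted only for the trivial characters. -/
theorem count_le {n t : ℕ} (hn : 0 < n) (ht : 0 < t) {δ : ℝ} (hδ0 : 0 ≤ δ)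
    (hδ : dim n * δ ≤ 1 / 4) (hδ1 : δ ≤ 1 / 4) :
    (count n t : ℝ) ≤ 2 ^ (n * t) * (Real.exp (-(11 / 24) * (t * δ ^ 2))
      + Real.exp (t * (n * δ) ^ 4) * normalizer n t) := by
  classical
  have hpi := Real.pi_pos
  have ht' : (0 : ℝ) < t := by exact_mod_cast ht
  obtain ⟨hG, hGi⟩ := integral_exp_neg_mul_sum_sq (ι := Pairs n) (b := (t : ℝ) / 2) (by positivity)
  set G : (Pairs n → ℝ) → ℝ := fun μ => Real.exp (-((t : ℝ) / 2) * ∑ p, μ p ^ 2)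
  set a := Real.exp (-(11 / 24) * (t * δ ^ 2))
  set b := Real.exp (t * (n * δ) ^ 4)
  set K := (univ.filter fun m : Pairs n → Fin 4 => ∀ z, pairChar m z = 1).card
  have hconst : ∀ c : ℝ, IntegrableOn (fun _ => c) (quarterCube n) := fun c =>
    continuousOn_const.integrableOn_compact (isCompact_quarterCube n)
  have hm : ∀ m : Pairs n → Fin 4, ∫ μ in quarterCube n, ‖charSum m μ‖ ^ t
      ≤ 2 ^ (n * t) * ((Real.pi / 2) ^ dim n * a
        + if ∀ z, pairChar m z = 1 then b * (2 * Real.pi / t) ^ ((dim n : ℝ) / 2) else 0) := by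
    intro m
    have hI : IntegrableOn (fun μ => if ∀ z, pairChar m z = 1 then b * G μ else 0)
        (quarterCube n) := by
      split_ifs
      · exact (hGi.const_mul b).integrableOn
      · exact hconst 0
    calc _ ≤ ∫ μ in quarterCube n, 2 ^ (n * t) * (a
          + if ∀ z, pairChar m z = 1 then b * G μ else 0) := by
          refine setIntegral_mono_on ?_ (((hconst a).add hI).const_mul _)
            (isCompact_quarterCube n).measurableSet
            fun μ hμ => norm_charSum_pow_le hδ0 hδ hδ1 m hμ
          exact ((continuous_charSum m).norm.pow t).continuousOn.integrableOn_compact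
            (isCompact_quarterCube n)
      _ = 2 ^ (n * t) * ((Real.pi / 2) ^ dim n * a
          + ∫ μ in quarterCube n, if ∀ z, pairChar m z = 1 then b * G μ else 0) := by
          rw [integral_const_mul, integral_add (hconst a) hI, setIntegral_const,
            volume_quarterCube, smul_eq_mul]
      _ ≤ _ := by
          gcongr
          split_ifs
          · rw [integral_const_mul]
            gcongr
            calc ∫ μ in quarterCube n, G μ ≤ ∫ μ, G μ :=
                  setIntegral_le_integral hGi (Filter.Eventually.of_forall fun μ =>
                    Real.exp_nonneg _)
              _ = _ := by
                rw [hG, card_pairs]; congr 1; field_simp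
          · simp
  have hcount := (count_mul_two_pi_pow_le n t).trans (Finset.sum_le_sum fun m _ => hm m)
  rw [← Finset.mul_sum, Finset.sum_add_distrib, Finset.sum_const, ← Finset.sum_filter,
    Finset.sum_const, Finset.card_univ, nsmul_eq_mul, nsmul_eq_mul] at hcount
  have hcard : (Fintype.card (Pairs n → Fin 4) : ℝ) = 4 ^ dim n := by simp [card_pairs]
  have hK : (K : ℝ) ≤ 2 ^ (2 * (dim n : ℤ) - (n : ℤ) + 1) := by
    have h : (K : ℝ) * 2 ^ n ≤ 2 * 4 ^ dim n := by
      exact_mod_cast card_trivial_pairChar_mul_le hn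
    rw [zpow_add₀ two_ne_zero, zpow_sub₀ two_ne_zero, zpow_mul, zpow_natCast, zpow_natCast,
      zpow_one, div_mul_eq_mul_div, le_div_iff₀ (by positivity)]
    norm_num
    linarith
  have hA : 2 ^ (2 * (dim n : ℤ) - (n : ℤ) + 1) * (2 * Real.pi / t) ^ ((dim n : ℝ) / 2)
      = normalizer n t * (2 * Real.pi) ^ dim n := by
    have e1 : (2 * Real.pi) ^ dim n
        = (2 * Real.pi) ^ ((dim n : ℝ) / 2) * (2 * Real.pi) ^ ((dim n : ℝ) / 2) := by
      rw [← Real.rpow_add (by positivity), add_halves, Real.rpow_natCast]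
    rw [normalizer, Real.rpow_neg (by positivity), Real.mul_rpow (by positivity) ht'.le,
      Real.div_rpow (by positivity) ht'.le, e1]
    field_simp
  have hpow : (4 : ℝ) ^ dim n * (Real.pi / 2) ^ dim n = (2 * Real.pi) ^ dim n := by
    rw [← mul_pow]; congr 1; ring
  have hfin : (count n t : ℝ) * (2 * Real.pi) ^ dim n
      ≤ (2 ^ (n * t) * (a + b * normalizer n t)) * (2 * Real.pi) ^ dim n := by
    refine hcount.trans ?_
    rw [hcard, ← mul_assoc ((4 : ℝ) ^ dim n), hpow]
    calc _ ≤ (2 : ℝ) ^ (n * t) * ((2 * Real.pi) ^ dim n * a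
          + 2 ^ (2 * (dim n : ℤ) - (n : ℤ) + 1)
            * (b * (2 * Real.pi / t) ^ ((dim n : ℝ) / 2))) := by gcongr
      _ = 2 ^ (n * t) * ((2 * Real.pi) ^ dim n * a
          + b * (2 ^ (2 * (dim n : ℤ) - (n : ℤ) + 1)
            * (2 * Real.pi / t) ^ ((dim n : ℝ) / 2))) := by ring
      _ = _ := by rw [hA]; ring
  exact le_of_mul_le_mul_right hfin (by positivity)

theorem ratio_le {n : ℕ} (hn : 4 ≤ n) {t : ℕ} (ht : n ^ 8 < t) :
    ratio n t ≤ Real.exp ((n : ℝ) ^ 4 * (t : ℝ) ^ (-(1 / 2) : ℝ))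
      + (t : ℝ) ^ ((dim n : ℝ) / 2) * Real.exp (-(11 / 24) * (t : ℝ) ^ (1 / 4 : ℝ)) := by
  have ht0 : 0 < t := by omega
  have ht' : (0 : ℝ) < t := by exact_mod_cast ht0
  have hnr : (4 : ℝ) ≤ n := by exact_mod_cast hn
  have hn0 : (0 : ℝ) < n := by linarith
  -- This choice gives `t δ² = t ^ (1/4)` and `t (nδ)⁴ = n⁴ t ^ (-1/2)`. The hypothesis `t > n ^ 8`
  -- yields `δ ≤ n ^ (-3)`, hence the smallness of `d δ`.
  set δ : ℝ := (t : ℝ) ^ (-(3 / 8) : ℝ) with hδ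
  have hδ0 : 0 < δ := by positivity
  have hδn : δ * (n : ℝ) ^ 3 ≤ 1 := by
    have h8 : (n : ℝ) ^ 8 ≤ t := by exact_mod_cast ht.le
    have : (n : ℝ) ^ 3 ≤ (t : ℝ) ^ (3 / 8 : ℝ) := by
      calc (n : ℝ) ^ 3 = ((n : ℝ) ^ 8) ^ (3 / 8 : ℝ) := by
            rw [← Real.rpow_natCast, ← Real.rpow_natCast, ← Real.rpow_mul hn0.le]; norm_num
        _ ≤ _ := by gcongr
    rw [hδ, Real.rpow_neg ht'.le, inv_mul_le_one₀ (by positivity)]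
    exact this
  have h64 : (64 : ℝ) ≤ (n : ℝ) ^ 3 := by
    calc (64 : ℝ) = 4 ^ 3 := by norm_num
      _ ≤ _ := by gcongr
  have hd : dim n * δ ≤ 1 / 4 := by
    have h1 := mul_le_mul_of_nonneg_right (dim_le_sq n) hδ0.le
    have h2 : 4 * ((n : ℝ) ^ 2 * δ) ≤ n * ((n : ℝ) ^ 2 * δ) := by gcongr
    nlinarith
  have hq : δ ≤ 1 / 4 := by nlinarith
  have hc := count_le (by omega) ht0 hδ0.le hd hq
  have e1 : (t : ℝ) * δ ^ 2 = (t : ℝ) ^ (1 / 4 : ℝ) := by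
    rw [hδ, ← Real.rpow_natCast, ← Real.rpow_mul ht'.le, ← Real.rpow_one_add' ht'.le (by norm_num)]
    norm_num
  have e2 : (t : ℝ) * (n * δ) ^ 4 = (n : ℝ) ^ 4 * (t : ℝ) ^ (-(1 / 2) : ℝ) := by
    rw [mul_pow, mul_left_comm, hδ, ← Real.rpow_natCast (_ ^ _), ← Real.rpow_mul ht'.le,
      ← Real.rpow_one_add' ht'.le (by norm_num)]
    norm_num
  rw [e1, e2] at hc
  have hA := normalizer_pos n ht'
  have hi := inv_normalizer_le hn ht'
  set a := Real.exp (-(11 / 24) * (t : ℝ) ^ (1 / 4 : ℝ))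
  have ha : 0 ≤ a := Real.exp_nonneg _
  have hle : a ≤ (t : ℝ) ^ ((dim n : ℝ) / 2) * a * normalizer n t := by
    have := mul_le_mul_of_nonneg_right hi (mul_nonneg ha hA.le)
    calc a = (normalizer n t)⁻¹ * (a * normalizer n t) := by field_simp
      _ ≤ _ := this
      _ = _ := by ring
  rw [ratio, div_le_iff₀ (by positivity)]
  calc (count n t : ℝ) ≤ _ := hc
    _ ≤ 2 ^ (n * t) * ((t : ℝ) ^ ((dim n : ℝ) / 2) * a * normalizer n t
        + Real.exp ((n : ℝ) ^ 4 * (t : ℝ) ^ (-(1 / 2) : ℝ)) * normalizer n t) := by gcongr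
    _ = _ := by ring

end FourierInversion

end PartialHadamard

theorem theorem5p1 :
    -- (i) abundance
    (∀ᶠ n : ℕ in Filter.atTop, ∀ t : ℕ, n ^ 8 < t →
      PartialHadamard.ratio n t ≤
        Real.exp ((n : ℝ) ^ 4 * (t : ℝ) ^ (-(1 / 2) : ℝ))
          + (t : ℝ) ^ ((PartialHadamard.dim n : ℝ) / 2)
            * Real.exp (-(11 / 24) * (t : ℝ) ^ (1 / 4 : ℝ))) ∧
    -- (ii) the lower bound for `t = n ^ (12 + 3 β + 2 α)`
    (∀ α β : ℝ, 0 < α → 0 < β → ∀ᶠ n : ℕ in Filter.atTop,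
      Real.exp (-(1 / 4) * (n : ℝ) ^ (-2 * α))
          + (PartialHadamard.normalizer n ((n : ℝ) ^ (12 + 3 * β + 2 * α)))⁻¹
            * Real.exp (-(11 / 24) * (n : ℝ) ^ (2 + β))
        < PartialHadamard.lowerBound n ((n : ℝ) ^ (12 + 3 * β + 2 * α))) ∧
    -- (ii) existence for all `t > n ^ 12`
    (∀ᶠ n : ℕ in Filter.atTop, ∀ t : ℕ, n ^ 12 < t →
      ∃ H : Matrix (Fin n) (Fin (4 * t)) ℤ, PartialHadamard.IsPartialHadamard H) ∧
    -- positive return probabilities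
    (∀ ε : ℝ, 0 < ε → ∀ᶠ n : ℕ in Filter.atTop, ∀ t : ℕ,
      (n : ℝ) ^ (12 + ε) ≤ (t : ℝ) → t % 4 = 0 →
        0 < PartialHadamard.transProb n t 0 0) := by
  refine ⟨?_, fun α β hα hβ => PartialHadamard.eventually_lowerBound_gt hα hβ, ?_,
    fun ε hε => PartialHadamard.eventually_transProb_pos hε⟩
  · filter_upwards [Filter.eventually_ge_atTop 4] with n hn t ht
    exact PartialHadamard.ratio_le hn ht
  · filter_upwards [Filter.eventually_ge_atTop 2] with n hn t ht
    exact PartialHadamard.realizable_of_pow_lt hn ht
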